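/- For every integer $n \ge 2$ there are constants $C_n$ and $m_n$, depending only on $n$, such that the following holds. Let $\mathbf F$ be a finite field of characteristic $p$, and let $N \trianglelefteq \Gamma \le \mathrm{GL}_n(\mathbf F)$. Assume that the section $\Sigma = \Gamma/N$ is trigonalizable, i.e. that there is a subgroup $B \le \mathrm{GL}_n(\mathbf F)$ which is conjugate, over some extension field $\mathbf E$ of $\mathbf F$, to a group of upper-triangular matrices in $\mathrm{GL}_n(\mathbf E)$, and such that $B \cap \Gamma$ maps onto $\Sigma$. Let $O_p(\Sigma)$ be the largest normal $p$-subgroup of $\Sigma$. A root of $\Sigma$ is a quotient homomorphism $\chi : \Sigma \to \Sigma/C_\Sigma(V)$, where $V$ is a $\Sigma$-composition factor of $O_p(\Sigma)$ (that is, $V = X/Y$ with $Y < X \le O_p(\Sigma)$ both normal in $\Sigma$ and with no normal subgroup of $\Sigma$ strictly between them) and $C_\Sigma(V)$ is the kernel of the conjugation action of $\Sigma$ on $V$. For real $R$, a set $A \subseteq \Sigma$ is said to have no $R$-small roots if there is no nontrivial root $\chi$ of $\Sigma$ with $1 < |\chi(A)| \le R$. Let $K$ be a real number and let $A \subseteq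 \Sigma$ be a set with $A = A^{-1}$ and $1 \in A$ such that (i) $|A^3| \le K|A|$, (ii) $A$ has no $K^{C_n}$-small roots, (iii) $A$ generates $\Sigma$. Then $\gamma_n(\Sigma) \subseteq A^{m_n}$, where $A^k = \{a_1\cdots a_k : a_1,\dots,a_k \in A\}$ and $\gamma_1(\Sigma) = \Sigma$, $\gamma_{k+1}(\Sigma) = [\gamma_k(\Sigma), \Sigma]$ is the lower central series. -/

import Mathlib

open scoped Pointwise

/-- A subgroup `B` of `GL_n(F)` is trigonalizable if, over some extension field `E` of `F`, it is
conjugate in `GL_n(E)` to a group of upper-triangular matrices. -/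
def IsTrigonalizable.{u} {n : ℕ} {F : Type u} [Field F]
    (B : Subgroup (Matrix.GeneralLinearGroup (Fin n) F)) : Prop :=
  ∃ (E : Type u) (_ : Field E) (_ : Algebra F E) (g : Matrix.GeneralLinearGroup (Fin n) E),
    ∀ b ∈ B, Matrix.BlockTriangular
      ((g * Matrix.GeneralLinearGroup.map (algebraMap F E) b * g⁻¹ :
        Matrix.GeneralLinearGroup (Fin n) E) : Matrix (Fin n) (Fin n) E) id

/-- The trace of a subset `A ⊆ G` in the section `H ⧸ N` of `G`: the image of `A ∩ H`. -/
def sectionTrace {G : Type*} [Group G] (A : Set G) (H : Subgroup G) (N : Subgroup H) :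
    Set (H ⧸ N) :=
  (fun x : H => (x : H ⧸ N)) '' {x : H | (x : G) ∈ A}

/-- The section `Γ ⧸ N` of `GL_n(F)` is trigonalizable if it is the trace of a trigonalizable
subgroup. -/
def IsTrigonalizableSection {n : ℕ} {F : Type*} [Field F]
    (Γ : Subgroup (Matrix.GeneralLinearGroup (Fin n) F)) (N : Subgroup Γ) : Prop :=
  ∃ B : Subgroup (Matrix.GeneralLinearGroup (Fin n) F),
    IsTrigonalizable B ∧ sectionTrace (B : Set (Matrix.GeneralLinearGroup (Fin n) F)) Γ N = Set.univ

/-- The `p`-core `O_p(S)`: the join of all normal `p`-subgroups, which for a finite group `S` is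
the largest normal `p`-subgroup. -/
def pCore (p : ℕ) (S : Type*) [Group S] : Subgroup S :=
  sSup {P : Subgroup S | P.Normal ∧ IsPGroup p P}

/-- The `S`-composition factors `top / bot` of a subgroup `U` of `S`, where `S` acts by
conjugation: `bot < top ≤ U` are `S`-invariant (that is, normal in `S`), with no `S`-invariant
subgroup strictly between them. -/
structure CompositionFactor {S : Type*} [Group S] (U : Subgroup S) where
  top : Subgroup S
  bot : Subgroup S
  top_normal : top.Normal
  bot_normal : bot.Normal
  top_le : top ≤ U
  bot_lt_top : bot < top
  eq_or_eq : ∀ Z : Subgroup S, Z.Normal → bot ≤ Z → Z ≤ top → Z = bot ∨ Z = top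

namespace CompositionFactor

instance instTopNormal {S : Type*} [Group S] {U : Subgroup S} (V : CompositionFactor U) :
    V.top.Normal := V.top_normal

instance instBotNormal {S : Type*} [Group S] {U : Subgroup S} (V : CompositionFactor U) :
    V.bot.Normal := V.bot_normal

/-- The centralizer `C_S(V)` of the composition factor `V = top / bot`: the elements of `S` acting
trivially on `V` by conjugation. -/
def rootKernel {S : Type*} [Group S] {U : Subgroup S} (V : CompositionFactor U) : Subgroup S where
  carrier := {g | ∀ x ∈ V.top, g * x * g⁻¹ * x⁻¹ ∈ V.bot}
  one_mem' := by
    intro x _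
    simp [V.bot.one_mem]
  mul_mem' := by
    intro a b ha hb x hx
    have h1 := ha _ (V.top_normal.conj_mem x hx b)
    have h2 := V.bot.mul_mem h1 (hb x hx)
    simpa [mul_assoc] using h2
  inv_mem' := by
    intro a ha x hx
    have h1 := V.bot.inv_mem (ha _ (V.top_normal.conj_mem x hx a⁻¹))
    simpa [mul_assoc] using h1

instance instRootKernelNormal {S : Type*} [Group S] {U : Subgroup S} (V : CompositionFactor U) :
    V.rootKernel.Normal where
  conj_mem := by
    intro a ha g x hx
    have h1 := V.bot_normal.conj_mem _ (ha _ (V.top_normal.conj_mem x hx g⁻¹)) g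
    simpa [mul_assoc] using h1

/-- The root attached to a composition factor `V`: the quotient map `S → S / C_S(V)`. -/
def root {S : Type*} [Group S] {U : Subgroup S} (V : CompositionFactor U) :
    S →* S ⧸ V.rootKernel :=
  QuotientGroup.mk' V.rootKernel

end CompositionFactor

/-- `A ⊆ S` has no `R`-small roots: there is no nontrivial root `χ` of `S`, arising from an
`S`-composition factor of `O_p(S)`, such that `1 < |χ(A)| ≤ R`. -/
def HasNoSmallRoots (p : ℕ) {S : Type*} [Group S] (A : Set S) (R : ℝ) : Prop :=
  ¬ ∃ V : CompositionFactor (pCore p S),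
    V.root ≠ 1 ∧ 1 < (V.root '' A).ncard ∧ ((V.root '' A).ncard : ℝ) ≤ R

/-- The lower central series with the indexing `γ_1(S) = S`, `γ_{k+1}(S) = [γ_k(S), S]`,
for `k ≥ 1`. -/
def gammaSeries (S : Type*) [Group S] (k : ℕ) : Subgroup S :=
  (⊤ : Subgroup S).lowerCentralSeries (k - 1)

/-!
In a triangular basis the section becomes `Σ = U T`, with `U` the image of the unipotent matrices
and `T` abelian of order prime to `p`. The group `U` is filtered by normal subgroups whose layers
are single matrix entries, on each of which an element of `Σ` acts trivially or without fixed
points, and `γ_n(Σ) ≤ D = [U, T]`.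

Small tripling bounds every `|A^k|` by a power of `K` times `|A|`, and counting cosets turns this
into bounds for the slices `A^k ∩ Z` by subgroups `Z`. Absence of small roots says that the image
of `A` in the action on a nontrivial layer is larger than any prescribed power of `K`. One descends
along a series of normal subgroups from `D` to `1`, showing at each term `Z` that words of bounded
length in `A` cover `D` modulo `Z`.

* On a noncentral factor the image of `A` supplies many commuting automorphisms with injective
  differences, and a pivoting argument as in the sum-product theorem applies: if the sums `w + s ξ`
  were all distinct for some `ξ` within reach, there would be too many words of bounded length;
  otherwise every vector is a quotient `(w - w') / (s - s')`, and the whole factor is covered.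
* On a central factor the elements are commutators. A character of the factor turns the commutator
  into a pairing on which `T` acts with large orbits, so its Fourier coefficients are small, and
  boundedly many commutators cover the factor.

If `K ^ 2 < 2` all of this degenerates, but then `A ^ 2` is already a subgroup.
-/

open scoped commutatorElement

section Collisions

open Finset

variable {α β : Type*} [DecidableEq β]

/-- The pairs of elements of `s` with the same image under `f`. -/
def collisions (s : Finset α) (f : α → β) : Finset (α × α) :=
  {x ∈ s ×ˢ s | f x.1 = f x.2}

lemma mem_collisions {s : Finset α} {f : α → β} {x y : α} :
    (x, y) ∈ collisions s f ↔ (x ∈ s ∧ y ∈ s) ∧ f x = f y := by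
  simp only [collisions, mem_filter, mem_product]

lemma card_collisions (s : Finset α) (f : α → β) :
    #(collisions s f) = ∑ b ∈ s.image f, #{a ∈ s | f a = b} ^ 2 := by
  classical
  rw [card_eq_sum_card_fiberwise (f := fun x => f x.1) (t := s.image f)]
  · refine sum_congr rfl fun b _ => ?_
    rw [sq, ← card_product]
    congr 1
    ext ⟨x, y⟩
    simp only [mem_filter, mem_collisions, mem_product]
    grind
  · rintro ⟨x, y⟩ hxy
    exact mem_image_of_mem f (mem_collisions.1 hxy).1.1

lemma card_sq_le_card_image_mul_card_collisions (s : Finset α) (f : α → β) :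
    #s ^ 2 ≤ #(s.image f) * #(collisions s f) := by
  rw [card_collisions, card_eq_sum_card_image f s]
  exact sq_sum_le_card_mul_sum_sq

end Collisions

section Pivot

open Finset

variable {V : Type*} [AddCommGroup V]

/-- A finite set of commuting injective endomorphisms, any two of which have an injective
difference. -/
structure IsSemiregularFamily (S : Finset (AddMonoid.End V)) : Prop where
  commute : ∀ s ∈ S, ∀ t ∈ S, Commute s t
  injective : ∀ s ∈ S, Function.Injective s
  sub_injective : ∀ s ∈ S, ∀ t ∈ S, s ≠ t → Function.Injective (s - t)

/-- The smallest subgroup containing `W` and mapped to itself by each element of `S`. -/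
def stableClosure (S : Finset (AddMonoid.End V)) (W : Finset V) : AddSubgroup V :=
  sInf {H | (W : Set V) ⊆ H ∧ ∀ s ∈ S, Set.MapsTo s H H}

/-- The elements of `V` of bounded length over `W` and `S` that the pivoting argument uses. -/
def pivotSet (S : Finset (AddMonoid.End V)) (W : Finset V) : Set V :=
  {v | ∃ s ∈ S, ∃ s' ∈ S, ∃ t ∈ S, ∃ t' ∈ S, ∃ a ∈ W, ∃ b ∈ W, ∃ w ∈ W, ∃ w' ∈ W,
    v = (s - s') (a + t b) + t (t' (w - w'))}

/-- The set `W + S ξ`. -/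
def translates [DecidableEq V] (S : Finset (AddMonoid.End V)) (W : Finset V) (ξ : V) : Finset V :=
  (W ×ˢ S).image fun x => x.1 + x.2 ξ

/-- The vector `ξ` is a pivot if the sums `w + s ξ` with `w ∈ W` and `s ∈ S` are distinct. -/
def IsPivot (S : Finset (AddMonoid.End V)) (W : Finset V) (ξ : V) : Prop :=
  Set.InjOn (fun x : V × AddMonoid.End V => x.1 + x.2 ξ) (W ×ˢ S : Finset _)

variable {S : Finset (AddMonoid.End V)} {W : Finset V}

section StableClosure

lemma subset_stableClosure : (W : Set V) ⊆ stableClosure S W :=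
  fun _ hw => AddSubgroup.mem_sInf.2 fun _ hH => hH.1 hw

lemma apply_mem_stableClosure {s : AddMonoid.End V} (hs : s ∈ S) {v : V}
    (hv : v ∈ stableClosure S W) : s v ∈ stableClosure S W :=
  AddSubgroup.mem_sInf.2 fun H hH => hH.2 s hs (AddSubgroup.mem_sInf.1 hv H hH)

lemma stableClosure_le {H : AddSubgroup V} (hW : (W : Set V) ⊆ H)
    (hS : ∀ s ∈ S, Set.MapsTo s H H) : stableClosure S W ≤ H :=
  sInf_le ⟨hW, hS⟩

end StableClosure

section Averaging

variable [DecidableEq V]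

lemma IsPivot.card_translates {ξ : V} (h : IsPivot S W ξ) : #(translates S W ξ) = #W * #S := by
  rw [translates, card_image_of_injOn h, card_product]

/-- For distinct `s`, `s'` the equation `w + s ξ = w' + s' ξ` has at most one solution `ξ`. -/
lemma IsSemiregularFamily.sum_card_collisions_le (hS : IsSemiregularFamily S) (W T : Finset V) :
    ∑ ξ ∈ T, #(collisions (W ×ˢ S) fun x => x.1 + x.2 ξ) ≤ (#W * #S) * (#T + #W * #S) := by
  classical
  have hpair : ∀ x ∈ (W ×ˢ S) ×ˢ (W ×ˢ S),
      #{ξ ∈ T | x.1.1 + x.1.2 ξ = x.2.1 + x.2.2 ξ} ≤ (if x.1 = x.2 then #T else 0) + 1 := by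
    rintro ⟨⟨w, s⟩, ⟨w', s'⟩⟩ hx
    simp only [mem_product] at hx
    rcases eq_or_ne s s' with rfl | hne
    · rcases eq_or_ne w w' with rfl | hww
      · simp
      · simp [hww]
    · refine le_add_left (card_le_one.2 fun a ha b hb => ?_)
      refine hS.sub_injective s hx.1.2 s' hx.2.2 hne ?_
      have hsub : ∀ {c : V}, w + s c = w' + s' c → (s - s') c = w' - w := fun {c} hc => by
        change s c - s' c = w' - w
        rw [sub_eq_sub_iff_add_eq_add, add_comm, hc]
      exact (hsub (mem_filter.1 ha).2).trans (hsub (mem_filter.1 hb).2).symm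
  calc ∑ ξ ∈ T, #(collisions (W ×ˢ S) fun x => x.1 + x.2 ξ)
      = ∑ x ∈ (W ×ˢ S) ×ˢ (W ×ˢ S), #{ξ ∈ T | x.1.1 + x.1.2 ξ = x.2.1 + x.2.2 ξ} := by
        simp only [collisions, card_filter]
        rw [sum_comm]
    _ ≤ ∑ x ∈ (W ×ˢ S) ×ˢ (W ×ˢ S), ((if x.1 = x.2 then #T else 0) + 1) := sum_le_sum hpair
    _ = (#W * #S) * (#T + #W * #S) := by
        rw [sum_add_distrib, sum_product]
        simp +contextual [sum_ite_eq, mul_add]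

lemma IsSemiregularFamily.exists_mul_le_card_translates_mul (hS : IsSemiregularFamily S)
    (W : Finset V) {T : Finset V} (hT : T.Nonempty) :
    ∃ ξ ∈ T, (#W * #S) * #T ≤ #(translates S W ξ) * (#T + #W * #S) := by
  by_contra! hlt
  set n := #W * #S with hn
  rcases Nat.eq_zero_or_pos n with h0 | hpos
  · obtain ⟨ξ, hξ⟩ := hT
    simpa [h0] using hlt ξ hξ
  have hcoll : ∀ ξ ∈ T, n * (#T + n) < #T * #(collisions (W ×ˢ S) fun x => x.1 + x.2 ξ) := by
    intro ξ hξ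
    have hCS := card_sq_le_card_image_mul_card_collisions (W ×ˢ S) fun x => x.1 + x.2 ξ
    rw [card_product, ← hn] at hCS
    set c := #(collisions (W ×ˢ S) fun x => x.1 + x.2 ξ)
    have hc : 0 < c := Nat.pos_of_mul_pos_left (lt_of_lt_of_le (by positivity) hCS)
    refine Nat.lt_of_mul_lt_mul_left (a := n) ?_
    calc n * (n * (#T + n)) = n ^ 2 * (#T + n) := by ring
      _ ≤ #(translates S W ξ) * c * (#T + n) := Nat.mul_le_mul_right _ hCS
      _ = #(translates S W ξ) * (#T + n) * c := by ring
      _ < n * #T * c := Nat.mul_lt_mul_of_pos_right (hlt ξ hξ) hc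
      _ = n * (#T * c) := by ring
  have hsum := sum_lt_sum_of_nonempty hT hcoll
  rw [sum_const, smul_eq_mul, ← mul_sum] at hsum
  exact (Nat.lt_of_mul_lt_mul_left hsum).not_ge (hS.sum_card_collisions_le W T)

end Averaging

lemma exists_sub_apply_eq_of_not_isPivot {ξ : V} (h : ¬ IsPivot S W ξ) :
    ∃ s ∈ S, ∃ s' ∈ S, s ≠ s' ∧ ∃ w ∈ W, ∃ w' ∈ W, (s - s') ξ = w - w' := by
  simp only [IsPivot, Set.InjOn, coe_product, Set.mem_prod, mem_coe, Prod.forall, Prod.mk.injEq]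
    at h
  push Not at h
  obtain ⟨w, s, ⟨hw, hs⟩, w', s', ⟨hw', hs'⟩, he, hne⟩ := h
  refine ⟨s, hs, s', hs', ?_, w', hw', w, hw, ?_⟩
  · rintro rfl
    exact hne (add_right_cancel he) rfl
  · change s ξ - s' ξ = w' - w
    rw [sub_eq_sub_iff_add_eq_add, add_comm, he]

namespace IsSemiregularFamily

lemma exists_sub_apply_mem_pivotSet (hS : IsSemiregularFamily S) {ξ : V} (hξ : ¬ IsPivot S W ξ)
    {t' : AddMonoid.End V} (ht' : t' ∈ S) {b : V} (hb : b ∈ W) :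
    ∃ s ∈ S, ∃ s' ∈ S, s ≠ s' ∧
      ∀ a ∈ W, ∀ t ∈ S, (s - s') (a + t (t' ξ + b)) ∈ pivotSet S W := by
  obtain ⟨s, hs, s', hs', hne, w, hw, w', hw', he⟩ := exists_sub_apply_eq_of_not_isPivot hξ
  refine ⟨s, hs, s', hs', hne, fun a ha t ht =>
    ⟨s, hs, s', hs', t, ht, t', ht', a, ha, b, hb, w, hw, w', hw', ?_⟩⟩
  have hcomm : Commute (s - s') (t * t') :=
    ((hS.commute s hs t ht).mul_right (hS.commute s hs t' ht')).sub_left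
      ((hS.commute s' hs' t ht).mul_right (hS.commute s' hs' t' ht'))
  have hmove : (s - s') (t (t' ξ)) = t (t' (w - w')) := by
    rw [← he]
    exact DFunLike.congr_fun hcomm.eq ξ
  rw [map_add t, map_add, map_add, map_add, hmove]
  abel

variable [Finite V]

lemma card_translates_le_ncard_pivotSet [DecidableEq V] (hS : IsSemiregularFamily S) {ξ : V}
    (hξ : ¬ IsPivot S W ξ) {t' : AddMonoid.End V} (ht' : t' ∈ S) {b : V} (hb : b ∈ W) :
    #(translates S W (t' ξ + b)) ≤ (pivotSet S W).ncard := by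
  obtain ⟨s, hs, s', hs', hne, hmem⟩ := hS.exists_sub_apply_mem_pivotSet hξ ht' hb
  rw [← card_image_of_injective _ (hS.sub_injective s hs s' hs' hne), ← Set.ncard_coe_finset]
  refine Set.ncard_le_ncard ?_ (Set.toFinite _)
  simp only [translates, coe_image, Set.image_image, Set.image_subset_iff]
  rintro ⟨a, t⟩ hat
  obtain ⟨ha, ht⟩ := mem_product.1 hat
  exact hmem a ha t ht

lemma not_isPivot_apply_add (hS : IsSemiregularFamily S) (hlt : (pivotSet S W).ncard < #W * #S)
    {ξ : V} (hξ : ¬ IsPivot S W ξ) {t' : AddMonoid.End V} (ht' : t' ∈ S) {b : V} (hb : b ∈ W) :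
    ¬ IsPivot S W (t' ξ + b) := by
  classical
  intro hpivot
  have := hS.card_translates_le_ncard_pivotSet hξ ht' hb
  rw [hpivot.card_translates] at this
  omega

/-- The translations preserving the set of non-pivots form a subgroup, which contains `W` and is
`S`-stable, since each element of `S` permutes the non-pivots. -/
lemma not_isPivot_of_mem_stableClosure (hS : IsSemiregularFamily S) (h1 : 1 ∈ S)
    (hS2 : S.Nontrivial) (hW0 : 0 ∈ W) (hlt : (pivotSet S W).ncard < #W * #S) {v : V}
    (hv : v ∈ stableClosure S W) : ¬ IsPivot S W v := by
  let N : Set V := {ξ | ¬ IsPivot S W ξ}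
  have hzero : (0 : V) ∈ N := fun hpivot => by
    obtain ⟨s, hs, s', hs', hne⟩ := hS2
    exact hne (Prod.ext_iff.1 (@hpivot (0, s) (by simp_all) (0, s') (by simp_all) (by simp))).2
  have hmaps : ∀ s ∈ S, Set.MapsTo s N N := fun s hs ξ (hξ : ¬ IsPivot S W ξ) => by
    have := hS.not_isPivot_apply_add hlt hξ hs hW0
    rwa [add_zero] at this
  have hle : stableClosure S W ≤ AddAction.stabilizer V N := by
    refine stableClosure_le (fun w hw => ?_) fun s hs v hv => ?_ <;>
      rw [SetLike.mem_coe, AddAction.mem_stabilizer_set' N.toFinite]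
    · intro ξ hξ
      rw [vadd_eq_add, add_comm]
      exact hS.not_isPivot_apply_add hlt hξ h1 hw
    · intro ξ hξ
      obtain ⟨η, hη, rfl⟩ := ((N.toFinite.injOn_iff_bijOn_of_mapsTo (hmaps s hs)).1
        (hS.injective s hs).injOn).surjOn hξ
      rw [vadd_eq_add, ← map_add]
      exact hmaps s hs ((AddAction.mem_stabilizer_set.1 hv η).2 hη)
  have := (AddAction.mem_stabilizer_set.1 (hle hv) 0).2 hzero
  rwa [vadd_eq_add, add_zero] at this

end IsSemiregularFamily

lemma subset_add_self_of_natCard_lt [Finite V] {H : AddSubgroup V} {Q : Set V}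
    (hQ : Q ⊆ H) (hcard : Nat.card H < 2 * Q.ncard) : (H : Set V) ⊆ Q + Q := by
  intro v hv
  have hsub : (v - ·) '' Q ⊆ H := by
    rintro _ ⟨q, hq, rfl⟩
    exact H.sub_mem hv (hQ hq)
  have hmeet : (Q ∩ (v - ·) '' Q).Nonempty := by
    by_contra hempty
    have hle := Set.ncard_le_ncard (Set.union_subset hQ hsub)
    rw [Set.ncard_union_eq
      (Set.disjoint_iff_inter_eq_empty.2 (Set.not_nonempty_iff_eq_empty.1 hempty)),
      Set.ncard_image_of_injective _ sub_right_injective, ← two_mul] at hle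
    exact hcard.not_ge hle
  obtain ⟨_, hq, r, hr, rfl⟩ := hmeet
  exact ⟨v - r, hq, r, hr, sub_add_cancel v r⟩

/-- If `ξ` is not a pivot, then some difference `s - s'` maps `W + S ξ` injectively into the pivot
set, and by averaging `ξ` can be chosen so that `W + S ξ` fills more than half of the closure. -/
theorem IsSemiregularFamily.stableClosure_subset_pivotSet_add_pivotSet [Finite V]
    (hS : IsSemiregularFamily S) (h1 : 1 ∈ S) (hS2 : S.Nontrivial) (hW0 : 0 ∈ W)
    (hlt : 2 * (pivotSet S W).ncard < #W * #S) :
    (stableClosure S W : Set V) ⊆ pivotSet S W + pivotSet S W := by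
  classical
  set H := stableClosure S W
  have hnot : ∀ ξ ∈ H, ¬ IsPivot S W ξ := fun ξ hξ =>
    hS.not_isPivot_of_mem_stableClosure h1 hS2 hW0 (by omega) hξ
  obtain ⟨ξ, hξ, hbig⟩ := hS.exists_mul_le_card_translates_mul W
    (T := (H : Set V).toFinite.toFinset) ⟨0, by simp⟩
  replace hξ : ξ ∈ H := by simpa using hξ
  rw [← Set.ncard_eq_toFinset_card] at hbig
  have hsmall : #(translates S W ξ) ≤ (pivotSet S W).ncard := by
    simpa using hS.card_translates_le_ncard_pivotSet (hnot ξ hξ) h1 hW0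
  have hhalf : Nat.card H < 2 * #(translates S W ξ) := by
    have : 0 < Nat.card H := Nat.card_pos
    change _ * Nat.card H ≤ _ * (Nat.card H + _) at hbig
    nlinarith
  obtain ⟨s, hs, s', hs', hne, hmem⟩ := hS.exists_sub_apply_mem_pivotSet (hnot ξ hξ) h1 hW0
  simp only [AddMonoid.End.coe_one, id_eq, add_zero] at hmem
  set Q := (s - s') '' translates S W ξ
  have hQpivot : Q ⊆ pivotSet S W := by
    rintro _ ⟨_, hv, rfl⟩
    obtain ⟨⟨a, t⟩, hat, rfl⟩ := mem_image.1 hv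
    exact hmem a (mem_product.1 hat).1 t (mem_product.1 hat).2
  have hQH : Q ⊆ H := by
    rintro _ ⟨_, hv, rfl⟩
    obtain ⟨⟨a, t⟩, hat, rfl⟩ := mem_image.1 hv
    have hmemH := H.add_mem (subset_stableClosure (mem_product.1 hat).1)
      (apply_mem_stableClosure (mem_product.1 hat).2 hξ)
    exact H.sub_mem (apply_mem_stableClosure hs hmemH) (apply_mem_stableClosure hs' hmemH)
  have hQcard : Q.ncard = #(translates S W ξ) := by
    rw [Set.ncard_image_of_injective _ (hS.sub_injective s hs s' hs' hne), Set.ncard_coe_finset]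
  exact (subset_add_self_of_natCard_lt hQH (by rwa [hQcard])).trans
    (Set.add_subset_add hQpivot hQpivot)

end Pivot

section Fourier

open Finset

variable {V I : Type*} [AddCommGroup V] [Fintype V]

lemma card_mul_card_collisions_eq_sum_norm_sq [DecidableEq V] {α : Type*} (s : Finset α)
    (f : α → V) :
    (Fintype.card V : ℝ) * #(collisions s f) = ∑ ψ : AddChar V ℂ, ‖∑ x ∈ s, ψ (f x)‖ ^ 2 := by
  have hsq (ψ : AddChar V ℂ) : ((‖∑ x ∈ s, ψ (f x)‖ ^ 2 : ℝ) : ℂ)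
      = ∑ x ∈ s ×ˢ s, ψ (f x.1 - f x.2) := by
    rw [Complex.ofReal_pow, ← Complex.mul_conj', map_sum, sum_mul_sum, sum_product]
    refine sum_congr rfl fun x _ => sum_congr rfl fun y _ => ?_
    rw [sub_eq_add_neg, AddChar.map_add_eq_mul, AddChar.map_neg_eq_conj]
  apply Complex.ofReal_injective
  rw [Complex.ofReal_sum, sum_congr rfl fun ψ _ => hsq ψ, sum_comm]
  simp only [AddChar.sum_apply_eq_ite, sub_eq_zero]
  rw [← sum_filter, sum_const, nsmul_eq_mul, mul_comm, collisions]
  push_cast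
  rfl

lemma card_mul_card_eq_sum_norm_sq (P : Finset V) :
    (Fintype.card V : ℝ) * #P = ∑ ψ : AddChar V ℂ, ‖∑ x ∈ P, ψ x‖ ^ 2 := by
  classical
  rw [← card_mul_card_collisions_eq_sum_norm_sq P fun x => x, card_collisions, image_id']
  congr 2
  rw [card_eq_sum_ones]
  exact sum_congr rfl fun x hx => by rw [filter_eq' P x, if_pos hx, card_singleton, one_pow]

variable [Fintype I] {b : I → V}

lemma card_mul_card_collisions_add_le [DecidableEq V] (P : Finset V) {c : ℝ}
    (hb : ∀ ψ : AddChar V ℂ, ψ ≠ 0 → ‖∑ i, ψ (b i)‖ ≤ c) :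
    (Fintype.card V : ℝ) * #(collisions (P ×ˢ univ) fun x : V × I => x.1 + b x.2)
      ≤ (#P * Fintype.card I) ^ 2 + c ^ 2 * (Fintype.card V * #P) := by
  have hfactor (ψ : AddChar V ℂ) : ‖∑ x ∈ P ×ˢ (univ : Finset I), ψ (x.1 + b x.2)‖ ^ 2
      = ‖∑ x ∈ P, ψ x‖ ^ 2 * ‖∑ i, ψ (b i)‖ ^ 2 := by
    rw [← mul_pow, ← norm_mul, sum_mul_sum, sum_product]
    simp only [AddChar.map_add_eq_mul]
  rw [card_mul_card_collisions_eq_sum_norm_sq, card_mul_card_eq_sum_norm_sq, mul_sum,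
    ← add_sum_erase _ _ (mem_univ (0 : AddChar V ℂ))]
  refine add_le_add (by rw [hfactor]; simp [mul_pow]) ?_
  calc ∑ ψ ∈ univ.erase (0 : AddChar V ℂ), ‖∑ x ∈ P ×ˢ (univ : Finset I), ψ (x.1 + b x.2)‖ ^ 2
      ≤ ∑ ψ ∈ univ.erase (0 : AddChar V ℂ), c ^ 2 * ‖∑ x ∈ P, ψ x‖ ^ 2 := by
        refine sum_le_sum fun ψ hψ => ?_
        rw [hfactor, mul_comm]
        gcongr
        exact hb ψ (ne_of_mem_erase hψ)
    _ ≤ ∑ ψ : AddChar V ℂ, c ^ 2 * ‖∑ x ∈ P, ψ x‖ ^ 2 :=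
        sum_le_sum_of_subset_of_nonneg (erase_subset _ _) fun _ _ _ => by positivity

/-- A measure whose nontrivial Fourier coefficients are small spreads out every set, so a set that
it barely enlarges is already large. -/
lemma card_lt_two_mul_card_of_fourier_small [Nonempty I] {P Q : Finset V} (hP : P.Nonempty) {q : ℝ}
    (hq : 0 < q) (hb : ∀ ψ : AddChar V ℂ, ψ ≠ 0 → q * ‖∑ i, ψ (b i)‖ ≤ Fintype.card I)
    (hQ : ∀ x ∈ P, ∀ i, x + b i ∈ Q) (hsmall : 2 * (#Q : ℝ) < q ^ 2 * #P) :
    Fintype.card V < 2 * #Q := by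
  classical
  set f := fun x : V × I => x.1 + b x.2
  have hupper := card_mul_card_collisions_add_le P (c := Fintype.card I / q) fun ψ hψ =>
    (le_div_iff₀' hq).2 (hb ψ hψ)
  have hlower : ((#P : ℝ) * Fintype.card I) ^ 2 ≤ #Q * #(collisions (P ×ˢ univ) f) := by
    have himage : (P ×ˢ univ).image f ⊆ Q :=
      image_subset_iff.2 fun x hx => hQ _ (mem_product.1 hx).1 _
    have hCS := (card_sq_le_card_image_mul_card_collisions (P ×ˢ univ) f).trans
      (Nat.mul_le_mul_right _ (card_le_card himage))
    rw [card_product, card_univ] at hCS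
    exact_mod_cast hCS
  have hPpos : (0 : ℝ) < #P := by exact_mod_cast hP.card_pos
  have hIpos : (0 : ℝ) < Fintype.card I := by exact_mod_cast Fintype.card_pos
  have hVpos : (0 : ℝ) < Fintype.card V := by exact_mod_cast Fintype.card_pos
  have hmain : (Fintype.card V : ℝ) * #P ≤ #Q * #P + #Q / q ^ 2 * Fintype.card V := by
    refine le_of_mul_le_mul_right ?_ (show 0 < (#P : ℝ) * (Fintype.card I : ℝ) ^ 2 by positivity)
    calc (Fintype.card V : ℝ) * #P * (#P * (Fintype.card I : ℝ) ^ 2)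
        = Fintype.card V * ((#P : ℝ) * Fintype.card I) ^ 2 := by ring
      _ ≤ Fintype.card V * ((#Q : ℝ) * #(collisions (P ×ˢ univ) f)) := by gcongr
      _ = (#Q : ℝ) * (Fintype.card V * #(collisions (P ×ˢ univ) f)) := by ring
      _ ≤ (#Q : ℝ) * (((#P : ℝ) * Fintype.card I) ^ 2
            + (Fintype.card I / q) ^ 2 * (Fintype.card V * #P)) := by gcongr
      _ = _ := by field_simp
  have hhalf : (#Q : ℝ) / q ^ 2 < #P / 2 := by
    rw [div_lt_iff₀ (by positivity)]
    linarith
  suffices (Fintype.card V : ℝ) < 2 * #Q by exact_mod_cast this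
  nlinarith [mul_lt_mul_of_pos_right hhalf hVpos]

end Fourier

section Commutators

variable {G : Type*} [Group G]

lemma commutator_le_iff_map_le_centralizer {N : Subgroup G} [N.Normal] {H K : Subgroup G} :
    ⁅H, K⁆ ≤ N ↔ H.map (QuotientGroup.mk' N) ≤
      Subgroup.centralizer (K.map (QuotientGroup.mk' N) : Set (G ⧸ N)) := by
  rw [← Subgroup.commutator_eq_bot_iff_le_centralizer, ← Subgroup.map_commutator,
    Subgroup.map_eq_bot_iff, QuotientGroup.ker_mk']

lemma sup_commutator_le {N : Subgroup G} [N.Normal] {H₁ H₂ K : Subgroup G}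
    (h₁ : ⁅H₁, K⁆ ≤ N) (h₂ : ⁅H₂, K⁆ ≤ N) : ⁅H₁ ⊔ H₂, K⁆ ≤ N := by
  rw [commutator_le_iff_map_le_centralizer] at *
  rw [Subgroup.map_sup]
  exact sup_le h₁ h₂

lemma commutator_sup_le {N : Subgroup G} [N.Normal] {H K₁ K₂ : Subgroup G}
    (h₁ : ⁅H, K₁⁆ ≤ N) (h₂ : ⁅H, K₂⁆ ≤ N) : ⁅H, K₁ ⊔ K₂⁆ ≤ N := by
  rw [Subgroup.commutator_comm] at *
  exact sup_commutator_le h₁ h₂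

lemma mem_of_pow_mem_of_coprime_orderOf {N : Subgroup G} {x : G} {n : ℕ}
    (h : n.Coprime (orderOf x)) (hx : x ^ n ∈ N) : x ∈ N := by
  obtain ⟨m, hm⟩ := exists_pow_eq_self_of_coprime h
  rw [← hm]
  exact N.pow_mem hx m

lemma commutatorElement_pow_left_of_commute {t u : G} (h : Commute t ⁅t, u⁆) (k : ℕ) :
    ⁅t ^ k, u⁆ = ⁅t, u⁆ ^ k := by
  induction k with
  | zero => simp
  | succ k ih =>
    rw [pow_succ, commutatorElement_mul_left_eq_conj_mul, ih, (h.pow_left k).mul_inv_cancel,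
      pow_succ']

lemma normal_of_closure_eq_top {A : Set G} (hA : A⁻¹ = A) (hgen : Subgroup.closure A = ⊤)
    {N : Subgroup G} (h : ∀ a ∈ A, ∀ x ∈ N, a * x * a⁻¹ ∈ N) : N.Normal := by
  rw [← Subgroup.normalizer_eq_top_iff, eq_top_iff, ← hgen, Subgroup.closure_le]
  intro a ha
  rw [SetLike.mem_coe, Subgroup.mem_normalizer_iff]
  refine fun x => ⟨h a ha x, fun hx => ?_⟩
  have ha' : a⁻¹ ∈ A := by rw [← hA]; simpa using ha
  simpa [mul_assoc] using h a⁻¹ ha' _ hx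

lemma normalClosure_image2_commutatorElement {A : Set G} (hgen : Subgroup.closure A = ⊤)
    (S : Set G) : Subgroup.normalClosure (Set.image2 (⁅·, ·⁆) S A) =
      ⁅Subgroup.normalClosure S, (⊤ : Subgroup G)⁆ := by
  set N := Subgroup.normalClosure (Set.image2 (⁅·, ·⁆) S A)
  apply le_antisymm
  · refine Subgroup.normalClosure_le_normal ?_
    rintro _ ⟨s, hs, a, -, rfl⟩
    exact Subgroup.commutator_mem_commutator (Subgroup.subset_normalClosure hs)
      (Subgroup.mem_top a)
  · rw [commutator_le_iff_map_le_centralizer,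
      Subgroup.map_top_of_surjective _ (QuotientGroup.mk'_surjective N), Subgroup.coe_top,
      Subgroup.centralizer_univ, Subgroup.map_le_iff_le_comap]
    refine Subgroup.normalClosure_le_normal fun s hs => ?_
    rw [SetLike.mem_coe, Subgroup.mem_comap, Subgroup.mem_center_iff]
    have hA : Subgroup.closure A ≤
        (Subgroup.centralizer {QuotientGroup.mk' N s}).comap (QuotientGroup.mk' N) := by
      refine (Subgroup.closure_le _).2 fun a ha => ?_
      rw [SetLike.mem_coe, Subgroup.mem_comap, Subgroup.mem_centralizer_singleton_iff, eq_comm,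
        ← commutatorElement_eq_one_iff_mul_comm, ← map_commutatorElement]
      exact (QuotientGroup.eq_one_iff _).2 (Subgroup.subset_normalClosure ⟨s, hs, a, ha, rfl⟩)
    intro g
    obtain ⟨g, rfl⟩ := QuotientGroup.mk'_surjective N g
    exact Subgroup.mem_centralizer_singleton_iff.1 (hA (hgen ▸ Subgroup.mem_top g))

end Commutators

section FixedPointFree

variable {G H : Type*} [Group G] [Group H]

/-- The subgroup of the elements of `G` acting trivially on the section `X / Y` by conjugation. -/
def layerKernel (X Y : Subgroup G) (hX : X.Normal) : Subgroup G where
  carrier := {g | ∀ x ∈ X, ⁅g, x⁆ ∈ Y}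
  one_mem' := by
    intro x _
    simp [Y.one_mem]
  mul_mem' := by
    intro a b ha hb x hx
    have h1 := ha _ (hX.conj_mem x hx b)
    have h2 := Y.mul_mem h1 (hb x hx)
    simpa [commutatorElement_def, mul_assoc] using h2
  inv_mem' := by
    intro a ha x hx
    have h1 := Y.inv_mem (ha _ (hX.conj_mem x hx a⁻¹))
    simpa [commutatorElement_def, mul_assoc] using h1

/-- Conjugation by `g` has no nontrivial fixed point in the section `X / Y`. -/
def FixedPointFreeOn (g : G) (X Y : Subgroup G) : Prop :=
  ∀ x ∈ X, ⁅g, x⁆ ∈ Y → x ∈ Y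

lemma commutatorElement_injOn {g : G} {X : Subgroup G} (hg : ∀ x ∈ X, ⁅g, x⁆ = 1 → x = 1) :
    Set.InjOn (⁅g, ·⁆) (X : Set G) := by
  intro a ha b hb (hab : ⁅g, a⁆ = ⁅g, b⁆)
  refine (inv_mul_eq_one.1 (hg _ (X.mul_mem (X.inv_mem hb) ha) ?_)).symm
  have hconj : g * (b⁻¹ * a) * g⁻¹ = b⁻¹ * (⁅g, b⁆⁻¹ * ⁅g, a⁆) * a := by
    simp only [commutatorElement_def]
    group
  rw [commutatorElement_def, hconj, hab]
  group

namespace FixedPointFreeOn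

variable {g : G} {X Y : Subgroup G}

/-- An injective self-map of the finite image of `S` in `G ⧸ Y` is onto. -/
lemma sup [Finite G] [Y.Normal] (hg : FixedPointFreeOn g X Y) {S : Subgroup G} (hSX : S ≤ X)
    (hgS : ∀ s ∈ S, g * s * g⁻¹ ∈ S) : FixedPointFreeOn g X (S ⊔ Y) := by
  set π := QuotientGroup.mk' Y
  have hmem : ∀ z, z ∈ S ⊔ Y ↔ π z ∈ S.map π := by
    intro z
    rw [← Subgroup.mem_comap, Subgroup.comap_map_eq, QuotientGroup.ker_mk']
  have hinj : Set.InjOn (⁅π g, ·⁆) (X.map π : Set (G ⧸ Y)) := by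
    refine commutatorElement_injOn ?_
    rintro _ ⟨x, hx, rfl⟩ hgx
    rw [← map_commutatorElement] at hgx
    exact (QuotientGroup.eq_one_iff _).2 (hg x hx ((QuotientGroup.eq_one_iff _).1 hgx))
  have hmaps : Set.MapsTo (⁅π g, ·⁆) (S.map π : Set (G ⧸ Y)) (S.map π) := by
    rintro _ ⟨s, hs, rfl⟩
    exact ⟨⁅g, s⁆, S.mul_mem (hgS s hs) (S.inv_mem hs), map_commutatorElement π _ _⟩
  have hsub : (S.map π : Set (G ⧸ Y)) ⊆ X.map π := Subgroup.map_mono hSX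
  have hsurj := (((Set.toFinite _).injOn_iff_bijOn_of_mapsTo hmaps).1 (hinj.mono hsub)).surjOn
  intro x hx hgx
  rw [hmem, map_commutatorElement] at hgx
  obtain ⟨y, hy, hyx⟩ := hsurj hgx
  rw [hmem, ← hinj (hsub hy) (Subgroup.mem_map_of_mem π hx) hyx]
  exact hy

lemma map [Finite G] [X.Normal] [Y.Normal] (hYX : Y ≤ X) (hg : FixedPointFreeOn g X Y)
    (π : G →* H) : FixedPointFreeOn (π g) (X.map π) (Y.map π) := by
  rintro _ ⟨x, hx, rfl⟩ hgx
  rw [← map_commutatorElement] at hgx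
  obtain ⟨y, hy, hyx⟩ := hgx
  have hgx : ⁅g, x⁆ ∈ X := X.mul_mem (Subgroup.Normal.conj_mem ‹_› x hx g) (X.inv_mem hx)
  have hker : ⁅g, x⁆ * y⁻¹ ∈ π.ker ⊓ X := by
    refine ⟨MonoidHom.mem_ker.2 ?_, X.mul_mem hgx (X.inv_mem (hYX hy))⟩
    rw [map_mul, map_inv, hyx, mul_inv_cancel]
  have hmem : ⁅g, x⁆ ∈ (π.ker ⊓ X) ⊔ Y := by
    simpa using Subgroup.mul_mem_sup hker hy
  have hx' := hg.sup inf_le_right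
    (fun s hs => Subgroup.Normal.conj_mem inferInstance s hs g) x hx hmem
  rw [Subgroup.mem_sup_of_normal_right] at hx'
  obtain ⟨k, hk, v, hv, rfl⟩ := hx'
  exact ⟨v, hv, by rw [map_mul, MonoidHom.mem_ker.1 hk.1, one_mul]⟩

end FixedPointFreeOn

end FixedPointFree

/-- A finite group `G = U 0 ⊔ T` with `U 0` normal and `T` abelian, of coprime orders, together with
a normal central series `U 0 ≥ U 1 ≥ ⋯ ≥ U L = 1` of `U 0`, on each layer of which every element
of `G` acts either trivially or without nontrivial fixed points. -/
structure IsLayered {G : Type*} [Group G] (L : ℕ) (U : ℕ → Subgroup G) (T : Subgroup G) :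
    Prop where
  normal : ∀ i, (U i).Normal
  antitone : Antitone U
  eq_bot : U L = ⊥
  commutator_le : ∀ i, ⁅U i, U 0⁆ ≤ U (i + 1)
  sup_eq_top : U 0 ⊔ T = ⊤
  comm : ∀ s ∈ T, ∀ t ∈ T, s * t = t * s
  coprime : (Nat.card (U 0)).Coprime (Nat.card T)
  semiregular : ∀ (i : ℕ) (g : G),
    g ∈ layerKernel (U i) (U (i + 1)) (normal i) ∨ FixedPointFreeOn g (U i) (U (i + 1))

namespace IsLayered

variable {G : Type*} [Group G] {L : ℕ} {U : ℕ → Subgroup G} {T : Subgroup G}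

lemma exists_mul_eq (h : IsLayered L U T) (g : G) : ∃ u ∈ U 0, ∃ t ∈ T, g = u * t := by
  have := h.normal 0
  have hg : g ∈ U 0 ⊔ T := h.sup_eq_top ▸ Subgroup.mem_top g
  rw [Subgroup.mem_sup_of_normal_left] at hg
  obtain ⟨u, hu, t, ht, rfl⟩ := hg
  exact ⟨u, hu, t, ht, rfl⟩

lemma zero_le_layerKernel (h : IsLayered L U T) (i : ℕ) :
    U 0 ≤ layerKernel (U i) (U (i + 1)) (h.normal i) := by
  intro u hu x hx
  rw [← commutatorElement_inv]
  exact inv_mem (h.commutator_le i (Subgroup.commutator_mem_commutator hx hu))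

lemma map (h : IsLayered L U T) [Finite G] {H : Type*} [Group H] (π : G →* H)
    (hπ : Function.Surjective π) : IsLayered L (fun i => (U i).map π) (T.map π) where
  normal i := (h.normal i).map π hπ
  antitone i j hij := Subgroup.map_mono (h.antitone hij)
  eq_bot := by rw [h.eq_bot, Subgroup.map_bot]
  commutator_le i := by
    rw [← Subgroup.map_commutator]
    exact Subgroup.map_mono (h.commutator_le i)
  sup_eq_top := by
    rw [← Subgroup.map_sup, h.sup_eq_top, Subgroup.map_top_of_surjective π hπ]
  comm := by
    rintro _ ⟨s, hs, rfl⟩ _ ⟨t, ht, rfl⟩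
    rw [← map_mul, h.comm s hs t ht, map_mul]
  coprime := (h.coprime.coprime_dvd_left (Subgroup.card_map_dvd _ π)).coprime_dvd_right
    (Subgroup.card_map_dvd _ π)
  semiregular i g := by
    obtain ⟨g, rfl⟩ := hπ g
    have := h.normal i
    have := h.normal (i + 1)
    refine (h.semiregular i g).imp ?_ (·.map (h.antitone i.le_succ) π)
    rintro hg _ ⟨x, hx, rfl⟩
    rw [← map_commutatorElement]
    exact Subgroup.mem_map_of_mem π (hg x hx)

lemma commutator_eq_bot (h : IsLayered L U T) : ⁅T, T⁆ = ⊥ :=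
  eq_bot_iff.2 <| Subgroup.commutator_le.2 fun s hs t ht =>
    commutatorElement_eq_one_iff_mul_comm.2 (h.comm s hs t ht)

lemma commutator_normal (h : IsLayered L U T) : (⁅U 0, T⁆).Normal := by
  rw [← Subgroup.normalizer_eq_top_iff, eq_top_iff, ← h.sup_eq_top]
  exact sup_le (Subgroup.normalizer_commutator_ge_left _ _)
    (Subgroup.normalizer_commutator_ge_right _ _)

lemma commutator_le_zero (h : IsLayered L U T) : ⁅U 0, T⁆ ≤ U 0 := by
  have := h.normal 0
  exact Subgroup.commutator_le_left _ _

lemma sup_normal (h : IsLayered L U T) : (⁅U 0, T⁆ ⊔ T).Normal := by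
  have := h.commutator_normal
  rw [← Subgroup.normalizer_eq_top_iff, eq_top_iff, ← h.sup_eq_top]
  refine sup_le (Subgroup.le_normalizer_iff_commutator_le_left.2 ?_)
    (le_sup_right.trans Subgroup.le_normalizer)
  exact (sup_commutator_le (Subgroup.commutator_le_left _ _)
    (Subgroup.commutator_comm T _).le).trans le_sup_left

lemma commutator_mem_zero (h : IsLayered L U T) (a b : G) : ⁅a, b⁆ ∈ U 0 := by
  have := h.normal 0
  have hT : IsMulCommutative T :=
    ⟨⟨fun s t => Subtype.ext (h.comm s s.2 t t.2)⟩⟩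
  exact (this.commutator_le_of_self_sup_commutative_eq_top h.sup_eq_top hT)
    (Subgroup.commutator_mem_commutator (Subgroup.mem_top a) (Subgroup.mem_top b))

lemma coprime_orderOf (h : IsLayered L U T) {x : G} (hx : x ∈ U 0) :
    (Nat.card T).Coprime (orderOf x) :=
  (h.coprime.coprime_dvd_left (Subgroup.orderOf_dvd_natCard _ hx)).symm

/-- Modulo the right-hand side, `⁅t, u⁆` commutes with `t`, so its `|T|`-th power is
`⁅t ^ |T|, u⁆ = 1`, whereas its order is prime to `|T|`. -/
lemma commutator_le_commutator_sup (h : IsLayered L U T) :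
    ⁅U 0, T⁆ ≤ ⁅⁅U 0, T⁆, ⁅U 0, T⁆ ⊔ T⁆ := by
  have hD := h.commutator_normal
  have hO := h.sup_normal
  set X := ⁅⁅U 0, T⁆, ⁅U 0, T⁆ ⊔ T⁆
  set π := QuotientGroup.mk' X
  rw [Subgroup.commutator_comm (U 0)]
  refine Subgroup.commutator_le.2 fun t ht u hu => ?_
  have htu : ⁅t, u⁆ ∈ ⁅U 0, T⁆ := by
    rw [Subgroup.commutator_comm]
    exact Subgroup.commutator_mem_commutator ht hu
  refine mem_of_pow_mem_of_coprime_orderOf (h.coprime_orderOf (h.commutator_le_zero htu))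
    ((QuotientGroup.eq_one_iff _).1 ?_)
  have hcomm : Commute (π t) ⁅π t, π u⁆ := by
    refine Commute.symm (commutatorElement_eq_one_iff_mul_comm.1 ?_)
    rw [← map_commutatorElement, ← map_commutatorElement]
    exact (QuotientGroup.eq_one_iff _).2
      (Subgroup.commutator_mem_commutator htu (Subgroup.mem_sup_right ht))
  have hone : t ^ Nat.card T = 1 := orderOf_dvd_iff_pow_eq_one.1 (T.orderOf_dvd_natCard ht)
  change π (⁅t, u⁆ ^ Nat.card T) = 1
  rw [map_pow, map_commutatorElement, ← commutatorElement_pow_left_of_commute hcomm, ← map_pow,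
    hone, map_one, commutatorElement_one_left]

lemma commutator_le_lowerCentralSeries (h : IsLayered L U T) (j : ℕ) :
    ⁅U 0, T⁆ ≤ (⊤ : Subgroup G).lowerCentralSeries j := by
  induction j with
  | zero => exact le_top
  | succ j ih =>
    exact h.commutator_le_commutator_sup.trans (Subgroup.commutator_mono ih le_top)

lemma lowerCentralSeries_le (h : IsLayered L U T) {V : ℕ → Subgroup G} (hV : ∀ j, (V j).Normal)
    (hV0 : V 0 = U 0) (hVle : ∀ j, V j ≤ U 0) (hVc : ∀ j, ⁅V j, U 0⁆ ≤ V (j + 1)) (j : ℕ) :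
    (⊤ : Subgroup G).lowerCentralSeries (j + 1) ≤ V (j + 1) ⊔ ⁅U 0, T⁆ := by
  have := h.commutator_normal
  have hlayer (j : ℕ) : ⁅V j, ⊤⁆ ≤ V (j + 1) ⊔ ⁅U 0, T⁆ := by
    have := hV (j + 1)
    rw [← h.sup_eq_top]
    exact commutator_sup_le ((hVc j).trans le_sup_left)
      ((Subgroup.commutator_mono (hVle j) le_rfl).trans le_sup_right)
  induction j with
  | zero =>
    have := hV 1
    rw [Subgroup.lowerCentralSeries_succ, Subgroup.lowerCentralSeries_zero]
    nth_rw 1 [← h.sup_eq_top]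
    refine sup_commutator_le (hV0 ▸ hlayer 0) ?_
    rw [← h.sup_eq_top]
    refine commutator_sup_le ?_ (h.commutator_eq_bot.trans_le bot_le)
    exact (Subgroup.commutator_comm T _).trans_le le_sup_right
  | succ j ih =>
    have := hV (j + 2)
    rw [Subgroup.lowerCentralSeries_succ]
    exact (Subgroup.commutator_mono ih le_rfl).trans (sup_commutator_le (hlayer (j + 1))
      ((Subgroup.commutator_le_left _ _).trans le_sup_right))

lemma lowerCentralSeries_eq (h : IsLayered L U T) :
    (⊤ : Subgroup G).lowerCentralSeries (L + 1) = ⁅U 0, T⁆ := by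
  refine le_antisymm ?_ (h.commutator_le_lowerCentralSeries _)
  have hbot : U (L + 1) = ⊥ := eq_bot_iff.2 (h.eq_bot ▸ h.antitone L.le_succ)
  simpa only [hbot, bot_sup_eq] using h.lowerCentralSeries_le h.normal rfl
    (fun j => h.antitone (Nat.zero_le j)) h.commutator_le L

end IsLayered

section Norm

variable {G C : Type*} [Group G] [CommGroup C] {M D T : Subgroup G} [M.Normal]

/-- The norm over `T` of a homomorphism `f : M → C`, namely `m ↦ ∏ t ∈ T, f (t m t⁻¹)`. -/
def conjNorm (T : Subgroup G) [Fintype T] (f : M →* C) : M →* C :=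
  ∏ t : T, f.comp (MulAut.conjNormal (t : G) : MulAut M).toMonoidHom

lemma conjNorm_apply [Fintype T] (f : M →* C) (m : M) :
    conjNorm T f m = ∏ t : T, f (MulAut.conjNormal (t : G) m) :=
  MonoidHom.finsetProd_apply _ _ _

lemma conjNorm_conj [Fintype T] [D.Normal] {f : M →* C}
    (hf : ∀ d ∈ D, ∀ m : M, f (MulAut.conjNormal d m) = f m) {o : G} (ho : o ∈ D ⊔ T) (m : M) :
    conjNorm T f (MulAut.conjNormal o m) = conjNorm T f m := by
  rw [Subgroup.mem_sup_of_normal_left] at ho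
  obtain ⟨d, hd, t, ht, rfl⟩ := ho
  rw [conjNorm_apply, conjNorm_apply]
  refine Fintype.prod_equiv (Equiv.mulRight (⟨t, ht⟩ : T)) _ _ fun s => ?_
  have hsd : (s : G) * d * (s : G)⁻¹ ∈ D := Subgroup.Normal.conj_mem inferInstance d hd s
  have hfactor : (s : G) * (d * t) = ((s : G) * d * (s : G)⁻¹) * (s * t) := by group
  rw [← MulAut.mul_apply, ← map_mul, hfactor, map_mul, MulAut.mul_apply, hf _ hsd]
  rfl

/-- The norm of `f` over `T` is invariant under `D T`, hence trivial on `⁅M, D T⁆`; where `f` is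
fixed by `T`, it is the `|T|`-th power of `f`. -/
lemma pow_card_eq_one_of_fixed [Finite T] [D.Normal] {f : M →* C}
    (hf : ∀ d ∈ D, ∀ m : M, f (MulAut.conjNormal d m) = f m) {x : M}
    (hx : (x : G) ∈ ⁅M, D ⊔ T⁆) (hfix : ∀ t ∈ T, f (MulAut.conjNormal t x) = f x) :
    f x ^ Nat.card T = 1 := by
  have := Fintype.ofFinite T
  have hle : ⁅M, D ⊔ T⁆ ≤ (conjNorm T f).ker.map M.subtype := by
    refine Subgroup.commutator_le.2 fun m hm o ho => ?_
    refine ⟨⟨m, hm⟩ * MulAut.conjNormal o ⟨m, hm⟩⁻¹, ?_, ?_⟩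
    · rw [SetLike.mem_coe, MonoidHom.mem_ker, map_mul, conjNorm_conj hf ho, map_inv,
        mul_inv_cancel]
    · simp [commutatorElement_def, mul_assoc]
  obtain ⟨y, hy, hyx⟩ := hle hx
  obtain rfl : y = x := Subtype.ext hyx
  rw [SetLike.mem_coe, MonoidHom.mem_ker, conjNorm_apply,
    Finset.prod_congr rfl fun (t : T) _ => hfix t t.2] at hy
  simpa [Nat.card_eq_fintype_card] using hy

end Norm

section WordLength

variable {G : Type*} [Group G] [DecidableEq G] {A : Finset G} {x y : G} {j k : ℕ}

lemma mul_mem_pow_add (hx : x ∈ A ^ j) (hy : y ∈ A ^ k) : x * y ∈ A ^ (j + k) := by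
  rw [pow_add]
  exact Finset.mul_mem_mul hx hy

lemma inv_mem_pow (hA : A⁻¹ = A) (hx : x ∈ A ^ j) : x⁻¹ ∈ A ^ j := by
  rw [← hA, inv_pow]
  exact Finset.inv_mem_inv hx

lemma commutatorElement_mem_pow (hA : A⁻¹ = A) (hx : x ∈ A ^ j) (hy : y ∈ A ^ k) :
    ⁅x, y⁆ ∈ A ^ (2 * j + 2 * k) := by
  have h := mul_mem_pow_add (mul_mem_pow_add (mul_mem_pow_add hx hy) (inv_mem_pow hA hx))
    (inv_mem_pow hA hy)
  rw [commutatorElement_def]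
  convert h using 2
  ring

lemma conj_mem_pow (hA : A⁻¹ = A) (hx : x ∈ A ^ j) (hy : y ∈ A ^ k) :
    x * y * x⁻¹ ∈ A ^ (k + 2 * j) := by
  have h := mul_mem_pow_add (mul_mem_pow_add hx hy) (inv_mem_pow hA hx)
  convert h using 2
  ring

/-- The word length, in the letters `a₀, …, aⱼ` and their inverses, of the iterated commutator
`⁅⋯⁅⁅a₀, a₁⁆, a₂⁆, …, aⱼ⁆`. -/
def commutatorLength : ℕ → ℕ
  | 0 => 1
  | j + 1 => 2 * commutatorLength j + 2

lemma exists_normalClosure_eq_lowerCentralSeries (hA : A⁻¹ = A)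
    (hgen : Subgroup.closure (A : Set G) = ⊤) (j : ℕ) :
    ∃ S : Set G, S ⊆ (A ^ commutatorLength j : Finset G) ∧
      Subgroup.normalClosure S = (⊤ : Subgroup G).lowerCentralSeries j := by
  induction j with
  | zero =>
    refine ⟨A, by simp [commutatorLength], ?_⟩
    rw [Subgroup.lowerCentralSeries_zero, eq_top_iff, ← hgen]
    exact Subgroup.closure_le_normalClosure
  | succ j ih =>
    obtain ⟨S, hS, hSj⟩ := ih
    refine ⟨Set.image2 (⁅·, ·⁆) S A, ?_, ?_⟩
    · rintro _ ⟨s, hs, a, ha, rfl⟩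
      exact commutatorElement_mem_pow hA (hS hs) ((pow_one A).symm ▸ ha)
    · rw [normalClosure_image2_commutatorElement hgen, hSj, Subgroup.lowerCentralSeries_succ]

end WordLength

lemma ncard_image_le_ncard_image {α β γ : Type*} {f : α → β} {g : α → γ} {s : Set α}
    (hs : s.Finite) (h : ∀ a ∈ s, ∀ b ∈ s, g a = g b → f a = f b) :
    (f '' s).ncard ≤ (g '' s).ncard := by
  set P := (fun a => (f a, g a)) '' s
  have hinj : Set.InjOn Prod.snd P := by
    rintro _ ⟨a, ha, rfl⟩ _ ⟨b, hb, rfl⟩ hab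
    exact Prod.ext (h a ha b hb hab) hab
  calc (f '' s).ncard = (Prod.fst '' P).ncard := by rw [Set.image_image]
    _ ≤ P.ncard := Set.ncard_image_le (hs.image _)
    _ = (Prod.snd '' P).ncard := hinj.ncard_image.symm
    _ = (g '' s).ncard := by rw [Set.image_image]

/-- A symmetric generating set `A` of bounded growth in a layered group, which has more than `R`
images in the automorphism group of each layer with nontrivial action. -/
structure GrowthData {G : Type*} [Group G] [DecidableEq G] (L : ℕ) (U : ℕ → Subgroup G)
    (T : Subgroup G) (A : Finset G) (K R : ℝ) : Prop extends IsLayered L U T where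
  inv_eq : A⁻¹ = A
  one_mem : 1 ∈ A
  closure_eq : Subgroup.closure (A : Set G) = ⊤
  one_le : 1 ≤ K
  growth : ∀ k : ℕ, 1 ≤ k → ((A ^ k).card : ℝ) ≤ K ^ k * A.card
  roots : ∀ i : ℕ, layerKernel (U i) (U (i + 1)) (normal i) = ⊤ ∨
    R < ((fun g : G => (g : G ⧸ layerKernel (U i) (U (i + 1)) (normal i))) '' A).ncard

namespace GrowthData

open Finset

variable {G : Type*} [Group G] [DecidableEq G] {L : ℕ} {U : ℕ → Subgroup G} {T : Subgroup G}
  {A : Finset G} {K R : ℝ}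

lemma pow_subset (h : GrowthData L U T A K R) {j k : ℕ} (hjk : j ≤ k) : A ^ j ⊆ A ^ k :=
  Finset.pow_subset_pow_right h.one_mem hjk

lemma nonneg (h : GrowthData L U T A K R) : 0 ≤ K := zero_le_one.trans h.one_le

lemma two_mul_pow_le (h : GrowthData L U T A K R) {j k : ℕ} (hjk : j ≤ k) (hR : 2 * K ^ k ≤ R) :
    2 * K ^ j ≤ R :=
  (mul_le_mul_of_nonneg_left (pow_le_pow_right₀ h.one_le hjk) zero_le_two).trans hR

section CosetCounting

open Classical in
lemma card_pow_inter_le (h : GrowthData L U T A K R) (Z : Subgroup G) [Z.Normal] (k : ℕ) :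
    (#{x ∈ A ^ k | x ∈ Z} : ℝ) ≤ K ^ (k + 1) * #{x ∈ A ^ 2 | x ∈ Z} := by
  have hupper := card_pow_quotient_mul_pow_inter_subgroup_le (A := A) (H := Z) (m := 1) (n := k)
  have hlower := le_card_quotient_mul_sq_inter_subgroup (H := Z) h.inv_eq
  rw [pow_one, add_comm 1 k] at hupper
  have hpos : (0 : ℝ) < #(A.image (QuotientGroup.mk' Z)) :=
    Nat.cast_pos.2 (Finset.image_nonempty.2 ⟨1, h.one_mem⟩).card_pos
  have hK := h.nonneg
  refine le_of_mul_le_mul_left ?_ hpos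
  calc (#(A.image (QuotientGroup.mk' Z)) : ℝ) * #{x ∈ A ^ k | x ∈ Z}
      ≤ #(A ^ (k + 1)) := by exact_mod_cast hupper
    _ ≤ K ^ (k + 1) * #A := h.growth (k + 1) (Nat.le_add_left 1 k)
    _ ≤ K ^ (k + 1) * (#(A.image (QuotientGroup.mk' Z)) * #{x ∈ A ^ 2 | x ∈ Z}) := by
        gcongr
        exact_mod_cast hlower
    _ = _ := by ring

open Classical in
lemma card_image_pow_le (h : GrowthData L U T A K R) (Y : Subgroup G) [Y.Normal] {k : ℕ}
    (hk : 1 ≤ k) :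
    (#(A.image (QuotientGroup.mk' Y) ^ k) : ℝ) ≤
      (K ^ 3) ^ k * #(A.image (QuotientGroup.mk' Y)) := by
  have hupper := card_pow_quotient_mul_pow_inter_subgroup_le (A := A) (H := Y) (m := k) (n := 2)
  have hlower := le_card_quotient_mul_sq_inter_subgroup (H := Y) h.inv_eq
  rw [Finset.image_pow] at hupper
  have hpos : (0 : ℝ) < #{x ∈ A ^ 2 | x ∈ Y} := Nat.cast_pos.2 <|
    Finset.card_pos.2 ⟨1, Finset.mem_filter.2 ⟨Finset.one_mem_pow h.one_mem, Y.one_mem⟩⟩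
  have hK := h.nonneg
  refine le_of_mul_le_mul_right ?_ hpos
  calc (#(A.image (QuotientGroup.mk' Y) ^ k) : ℝ) * #{x ∈ A ^ 2 | x ∈ Y}
      ≤ #(A ^ (k + 2)) := by exact_mod_cast hupper
    _ ≤ K ^ (k + 2) * #A := h.growth (k + 2) (by omega)
    _ ≤ (K ^ 3) ^ k * (#(A.image (QuotientGroup.mk' Y)) * #{x ∈ A ^ 2 | x ∈ Y}) := by
        rw [← pow_mul]
        gcongr
        · exact h.one_le
        · omega
        · exact_mod_cast hlower
    _ = _ := by ring

end CosetCounting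

lemma lt_ncard_image_of_quotient (h : GrowthData L U T A K R) [Finite G] {H : Type*} [Group H]
    (π : G →* H) (hπ : Function.Surjective π) (i : ℕ) :
    layerKernel ((U i).map π) ((U (i + 1)).map π) ((h.normal i).map π hπ) = ⊤ ∨
      R < ((fun g : H => (g : H ⧸ layerKernel ((U i).map π) ((U (i + 1)).map π)
        ((h.normal i).map π hπ))) '' (π '' A)).ncard := by
  have := h.normal i
  have := h.normal (i + 1)
  by_cases htriv : (U i).map π ≤ (U (i + 1)).map π
  · left
    have hn := (h.normal (i + 1)).map π hπ
    exact eq_top_iff.2 fun g _ x hx => mul_mem (hn.conj_mem x (htriv hx) g) (inv_mem (htriv hx))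
  refine (h.roots i).imp (fun hi => eq_top_iff.2 fun g _ => ?_) fun hi => hi.trans_le ?_
  · obtain ⟨g, rfl⟩ := hπ g
    rintro _ ⟨x, hx, rfl⟩
    rw [← map_commutatorElement]
    exact Subgroup.mem_map_of_mem π (hi.ge (Subgroup.mem_top g) x hx)
  · rw [Set.image_image]
    refine Nat.cast_le.2 (ncard_image_le_ncard_image A.finite_toSet fun a _ b _ hab => ?_)
    rw [QuotientGroup.eq] at hab ⊢
    rw [← map_inv, ← map_mul] at hab
    refine (h.semiregular i (a⁻¹ * b)).resolve_right fun hfix => htriv fun x hx => ?_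
    exact hfix.map (h.antitone i.le_succ) π x hx (hab x hx)

open Classical in
lemma quotient (h : GrowthData L U T A K R) [Finite G] (Y : Subgroup G) [Y.Normal] :
    GrowthData L (fun i => (U i).map (QuotientGroup.mk' Y)) (T.map (QuotientGroup.mk' Y))
      (A.image (QuotientGroup.mk' Y)) (K ^ 3) R where
  toIsLayered := h.toIsLayered.map _ (QuotientGroup.mk'_surjective Y)
  inv_eq := by rw [← Finset.image_inv, h.inv_eq]
  one_mem := Finset.mem_image.2 ⟨1, h.one_mem, map_one _⟩
  closure_eq := by
    rw [Finset.coe_image, ← MonoidHom.map_closure, h.closure_eq,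
      Subgroup.map_top_of_surjective _ (QuotientGroup.mk'_surjective Y)]
  one_le := one_le_pow₀ h.one_le
  growth _ hk := h.card_image_pow_le Y hk
  roots i := by
    rw [Finset.coe_image]
    exact h.lt_ncard_image_of_quotient _ (QuotientGroup.mk'_surjective Y) i

lemma commutator_le_of_pow_inter_subset (h : GrowthData L U T A K R) {m : ℕ}
    (hm : commutatorLength (L + 1) ≤ m) {N : Subgroup G} (hN : N.Normal)
    (hAN : ∀ x ∈ A ^ m, x ∈ ⁅U 0, T⁆ → x ∈ N) : ⁅U 0, T⁆ ≤ N := by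
  obtain ⟨S, hS, hSeq⟩ :=
    exists_normalClosure_eq_lowerCentralSeries h.inv_eq h.closure_eq (L + 1)
  rw [h.lowerCentralSeries_eq] at hSeq
  rw [← hSeq]
  refine Subgroup.normalClosure_le_normal fun s hs => hAN s (h.pow_subset hm (hS hs)) ?_
  rw [← hSeq]
  exact Subgroup.subset_normalClosure hs

end GrowthData

section ConjugationAction

open Finset

variable {G : Type*} [Group G] {Z : Subgroup G} [DecidableEq G] {A : Finset G} {j k : ℕ}
  {v w : Additive Z}

/-- The words of length `k` over `A` that lie in `Z`, written additively so that the results on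
abelian groups apply. -/
noncomputable def wordSlice (A : Finset G) (Z : Subgroup G) (k : ℕ) : Finset (Additive Z) :=
  (A ^ k).preimage (fun v => (v.toMul : G))
    (Subtype.val_injective.comp Additive.toMul.injective).injOn

lemma mem_wordSlice : v ∈ wordSlice A Z k ↔ (v.toMul : G) ∈ A ^ k := by
  rw [wordSlice, Finset.mem_preimage]

open Classical in
lemma card_wordSlice : #(wordSlice A Z k) = #{x ∈ A ^ k | x ∈ Z} := by
  rw [wordSlice, Finset.card_preimage]
  congr 1
  refine Finset.filter_congr fun x _ => ⟨?_, fun hx => ⟨Additive.ofMul ⟨x, hx⟩, rfl⟩⟩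
  rintro ⟨v, rfl⟩
  exact v.toMul.2

lemma GrowthData.card_wordSlice_le {L : ℕ} {U : ℕ → Subgroup G} {T : Subgroup G} {K R : ℝ}
    (h : GrowthData L U T A K R) [Z.Normal] {l : ℕ} (hk : 2 ≤ k) :
    (#(wordSlice A Z l) : ℝ) ≤ K ^ (l + 1) * #(wordSlice A Z k) := by
  classical
  rw [card_wordSlice, card_wordSlice]
  have hK := h.nonneg
  refine (h.card_pow_inter_le Z l).trans ?_
  gcongr
  exact h.one_mem

lemma zero_mem_wordSlice (hone : 1 ∈ A) : 0 ∈ wordSlice A Z k :=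
  mem_wordSlice.2 (Finset.one_mem_pow hone)

lemma add_mem_wordSlice (hv : v ∈ wordSlice A Z j) (hw : w ∈ wordSlice A Z k) :
    v + w ∈ wordSlice A Z (j + k) :=
  mem_wordSlice.2 (mul_mem_pow_add (mem_wordSlice.1 hv) (mem_wordSlice.1 hw))

lemma neg_mem_wordSlice (hA : A⁻¹ = A) (hv : v ∈ wordSlice A Z k) : -v ∈ wordSlice A Z k :=
  mem_wordSlice.2 (inv_mem_pow hA (mem_wordSlice.1 hv))

variable [Z.Normal]

omit [DecidableEq G] in
/-- Conjugation in the normal subgroup `Z`, written additively. -/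
def conjEnd (Z : Subgroup G) [Z.Normal] : G →* AddMonoid.End (Additive Z) where
  toFun a := (MulAut.conjNormal a : MulAut Z).toMonoidHom.toAdditive
  map_one' := by
    rw [map_one]
    rfl
  map_mul' a b := by
    rw [map_mul]
    rfl

omit [DecidableEq G] in
lemma coe_conjEnd_apply (a : G) (v : Additive Z) :
    ((conjEnd Z a v).toMul : G) = a * (v.toMul : G) * a⁻¹ := rfl

omit [DecidableEq G] in
lemma conjEnd_apply_eq_iff {a b : G} :
    conjEnd Z a v = conjEnd Z b v ↔ ⁅a⁻¹ * b, (v.toMul : G)⁆ = 1 := by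
  have hconj : ⁅a⁻¹ * b, (v.toMul : G)⁆ =
      a⁻¹ * ((b * (v.toMul : G) * b⁻¹) * (a * (v.toMul : G) * a⁻¹)⁻¹) * a := by
    rw [commutatorElement_def]
    group
  rw [hconj, ← coe_conjEnd_apply, ← coe_conjEnd_apply, mul_assoc, inv_mul_eq_one,
    right_eq_mul, mul_inv_eq_one, Subtype.coe_inj]
  exact eq_comm

lemma conjEnd_mem_wordSlice [DecidableEq (AddMonoid.End (Additive Z))] (hA : A⁻¹ = A)
    {s : AddMonoid.End (Additive Z)} (hs : s ∈ A.image (conjEnd Z))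
    (hv : v ∈ wordSlice A Z k) : s v ∈ wordSlice A Z (k + 2) := by
  obtain ⟨a, ha, rfl⟩ := Finset.mem_image.1 hs
  exact mem_wordSlice.2
    (conj_mem_pow (j := 1) hA ((pow_one A).symm ▸ ha) (mem_wordSlice.1 hv))

open scoped IsMulCommutative

variable [IsMulCommutative Z] [DecidableEq (AddMonoid.End (Additive Z))]

lemma pivotSet_subset_wordSlice (hA : A⁻¹ = A) :
    pivotSet (A.image (conjEnd Z)) (wordSlice A Z k) ⊆ wordSlice A Z (6 * k + 12) := by
  rintro _ ⟨s, hs, s', hs', t, ht, t', ht', a, ha, b, hb, w, hw, w', hw', rfl⟩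
  have hab := add_mem_wordSlice ha (conjEnd_mem_wordSlice hA ht hb)
  have hdiff := add_mem_wordSlice (conjEnd_mem_wordSlice hA hs hab)
    (neg_mem_wordSlice hA (conjEnd_mem_wordSlice hA hs' hab))
  have hww' := conjEnd_mem_wordSlice hA ht (conjEnd_mem_wordSlice hA ht'
    (add_mem_wordSlice hw (neg_mem_wordSlice hA hw')))
  have hlength : k + (k + 2) + 2 + (k + (k + 2) + 2) + (k + k + 2 + 2) = 6 * k + 12 := by ring
  rw [Finset.mem_coe, ← hlength, sub_eq_add_neg w]
  convert add_mem_wordSlice hdiff hww' using 2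
  exact (AddMonoidHom.sub_apply s s' _).trans (sub_eq_add_neg _ _)

omit [DecidableEq G] in
lemma isSemiregularFamily_image_conjEnd
    (hcomm : ∀ a b : G, ⁅a, b⁆ ∈ Subgroup.centralizer (Z : Set G))
    (hdich : ∀ g : G, g ∈ Subgroup.centralizer (Z : Set G) ∨ FixedPointFreeOn g Z ⊥)
    (A : Finset G) : IsSemiregularFamily (A.image (conjEnd Z)) where
  commute := by
    simp only [Finset.forall_mem_image]
    intro a _ b _
    refine DFunLike.ext _ _ fun v => ?_
    rw [← map_mul, ← map_mul, conjEnd_apply_eq_iff, commutatorElement_eq_one_iff_mul_comm]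
    convert (Subgroup.mem_centralizer_iff.1 (hcomm b⁻¹ a⁻¹) _ v.toMul.2).symm using 2 <;>
      · rw [commutatorElement_def]
        group
  injective := by
    simp only [Finset.forall_mem_image]
    intro a _ v w hvw
    apply Subtype.ext
    have : a * (v.toMul : G) * a⁻¹ = a * (w.toMul : G) * a⁻¹ := congrArg Subtype.val hvw
    exact mul_left_cancel (mul_right_cancel this)
  sub_injective := by
    simp only [Finset.forall_mem_image]
    intro a _ b _ hne
    refine (injective_iff_map_eq_zero _).2 fun v hv => ?_
    have hv : ⁅a⁻¹ * b, (v.toMul : G)⁆ = 1 := conjEnd_apply_eq_iff.1 (sub_eq_zero.1 hv)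
    refine (hdich (a⁻¹ * b)).elim (fun hg => absurd ?_ hne) fun hg =>
      Subtype.ext (Subgroup.mem_bot.1 (hg _ v.toMul.2 (Subgroup.mem_bot.2 hv)))
    refine DFunLike.ext _ _ fun w => conjEnd_apply_eq_iff.2 ?_
    exact commutatorElement_eq_one_iff_mul_comm.2
      (Subgroup.mem_centralizer_iff.1 hg _ w.toMul.2).symm

/-- The pivoting argument: the normal subgroup generated by the words of length `k` in `Z` is the
stable closure of these words under conjugation. -/
theorem exists_normal_subset_pow_of_card_wordSlice_lt [Finite Z] (hA : A⁻¹ = A) (hone : 1 ∈ A)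
    (hgen : Subgroup.closure (A : Set G) = ⊤)
    (hS : IsSemiregularFamily (A.image (conjEnd Z))) (hS2 : (A.image (conjEnd Z)).Nontrivial)
    (hlt : 2 * #(wordSlice A Z (6 * k + 12)) < #(wordSlice A Z k) * #(A.image (conjEnd Z))) :
    ∃ N : Subgroup G, N.Normal ∧ (∀ x ∈ A ^ k, x ∈ Z → x ∈ N) ∧ ∀ x ∈ N, x ∈ A ^ (12 * k + 24) := by
  set S := A.image (conjEnd Z)
  have hsub : pivotSet S (wordSlice A Z k) ⊆ wordSlice A Z (6 * k + 12) :=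
    pivotSet_subset_wordSlice hA
  have hcard : (pivotSet S (wordSlice A Z k)).ncard ≤ #(wordSlice A Z (6 * k + 12)) := by
    rw [← Set.ncard_coe_finset]
    exact Set.ncard_le_ncard hsub
  have hcover := hS.stableClosure_subset_pivotSet_add_pivotSet (W := wordSlice A Z k)
    (Finset.mem_image.2 ⟨1, hone, map_one _⟩) hS2 (zero_mem_wordSlice hone) (by omega)
  refine ⟨(Subgroup.toAddSubgroup.symm (stableClosure S (wordSlice A Z k))).map Z.subtype,
    normal_of_closure_eq_top (A := (A : Set G)) ?_ hgen ?_, ?_, ?_⟩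
  · rw [← coe_inv, hA]
  · rintro a ha _ ⟨z, hz, rfl⟩
    exact ⟨_, apply_mem_stableClosure (V := Additive Z) (Finset.mem_image_of_mem _ ha) hz, rfl⟩
  · intro x hx hxZ
    have hmem : Additive.ofMul (⟨x, hxZ⟩ : Z) ∈ stableClosure S (wordSlice A Z k) :=
      subset_stableClosure (mem_wordSlice.2 hx)
    exact ⟨⟨x, hxZ⟩, hmem, rfl⟩
  · rintro _ ⟨z, hz, rfl⟩
    obtain ⟨v, hv, w, hw, hvw⟩ := hcover hz
    have hsum := add_mem_wordSlice (hsub hv) (hsub hw)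
    rw [show v + w = Additive.ofMul z from hvw, mem_wordSlice] at hsum
    have hlength : 12 * k + 24 = 6 * k + 12 + (6 * k + 12) := by ring
    rw [hlength]
    exact hsum

end ConjugationAction

section LayerComplement

variable {G : Type*} [Group G] {X Y Z : Subgroup G} [Z.Normal]

lemma layerKernel_le_centralizer (hX : X.Normal) (hZX : Z ≤ X) (hZY : Disjoint Z Y) :
    layerKernel X Y hX ≤ Subgroup.centralizer (Z : Set G) := by
  intro g hg
  refine Subgroup.mem_centralizer_iff_commutator_eq_one.2 fun z hz => ?_
  have hgz : ⁅g, z⁆ ∈ Z :=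
    Z.mul_mem (Subgroup.Normal.conj_mem inferInstance z hz g) (Z.inv_mem hz)
  rw [← commutatorElement_inv, inv_eq_one]
  exact Subgroup.disjoint_def.1 hZY hgz (hg z (hZX hz))

omit [Z.Normal] in
lemma FixedPointFreeOn.of_disjoint {g : G} (hg : FixedPointFreeOn g X Y) (hZX : Z ≤ X)
    (hZY : Disjoint Z Y) : FixedPointFreeOn g Z ⊥ := by
  intro z hz hgz
  refine Subgroup.mem_bot.2 (Subgroup.disjoint_def.1 hZY hz (hg z (hZX hz) ?_))
  rw [Subgroup.mem_bot.1 hgz]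
  exact Y.one_mem

variable {L i : ℕ} {U : ℕ → Subgroup G} {T : Subgroup G}

lemma IsLayered.zero_le_centralizer (h : IsLayered L U T) (hZi : Z ≤ U i)
    (hZ : Disjoint Z (U (i + 1))) : U 0 ≤ Subgroup.centralizer (Z : Set G) :=
  (h.zero_le_layerKernel i).trans (layerKernel_le_centralizer (h.normal i) hZi hZ)

lemma IsLayered.isMulCommutative (h : IsLayered L U T) (hZi : Z ≤ U i)
    (hZ : Disjoint Z (U (i + 1))) : IsMulCommutative Z :=
  ⟨⟨fun x y => Subtype.ext <| Subgroup.mem_centralizer_iff.1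
    (h.zero_le_centralizer hZi hZ (h.antitone (Nat.zero_le i) (hZi y.2))) x x.2⟩⟩

end LayerComplement

section Semiregular

open Finset

variable {G : Type*} [Group G] [DecidableEq G] {A : Finset G}

/-- Every element of `D` is a word of length `m` over `A` up to an element of `Z`. -/
def CoveredModulo (A : Finset G) (m : ℕ) (D Z : Subgroup G) : Prop :=
  ∀ x ∈ D, ∃ a ∈ A ^ m, ∃ z ∈ Z, a * z = x

/-- The hypothesis on words of length `2 m` makes `(A ^ m ∩ D) N` closed under multiplication. -/
lemma exists_normal_coe_eq_mul (hA : A⁻¹ = A) (hone : 1 ∈ A)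
    (hgen : Subgroup.closure (A : Set G) = ⊤) {D N : Subgroup G} [D.Normal] [N.Normal] {m : ℕ}
    (hm : 2 ≤ m)
    (hDN : ↑(A ^ (2 * m)) ∩ (D : Set G) ⊆ (↑(A ^ m) ∩ (D : Set G)) * (N : Set G)) :
    ∃ B : Subgroup G, B.Normal ∧ (B : Set G) = (↑(A ^ m) ∩ (D : Set G)) * (N : Set G) := by
  let B : Subgroup G :=
    { carrier := (↑(A ^ m) ∩ (D : Set G)) * (N : Set G)
      one_mem' := ⟨1, ⟨Finset.one_mem_pow hone, D.one_mem⟩, 1, N.one_mem, one_mul 1⟩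
      mul_mem' := by
        rintro _ _ ⟨w, ⟨hw, hwD⟩, z, hz, rfl⟩ ⟨w', ⟨hw', hwD'⟩, z', hz', rfl⟩
        have hlength := mul_mem_pow_add hw hw'
        rw [← two_mul] at hlength
        obtain ⟨v, hv, y, hy, hvy⟩ := hDN ⟨hlength, D.mul_mem hwD hwD'⟩
        have hconj := Subgroup.Normal.conj_mem ‹N.Normal› z hz w'⁻¹
        refine ⟨v, hv, y * (w'⁻¹ * z * w'⁻¹⁻¹) * z', N.mul_mem (N.mul_mem hy hconj) hz', ?_⟩
        calc v * (y * (w'⁻¹ * z * w'⁻¹⁻¹) * z') = v * y * (w'⁻¹ * z * w'⁻¹⁻¹) * z' := by group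
          _ = w * w' * (w'⁻¹ * z * w'⁻¹⁻¹) * z' := by rw [← hvy]
          _ = w * z * (w' * z') := by group
      inv_mem' := by
        rintro _ ⟨w, ⟨hw, hwD⟩, z, hz, rfl⟩
        exact ⟨w⁻¹, ⟨inv_mem_pow hA hw, D.inv_mem hwD⟩, w * z⁻¹ * w⁻¹,
          Subgroup.Normal.conj_mem ‹N.Normal› _ (N.inv_mem hz) w, by group⟩ }
  refine ⟨B, normal_of_closure_eq_top (A := (A : Set G)) (by rw [← coe_inv, hA]) hgen ?_, rfl⟩
  rintro a ha _ ⟨w, ⟨hw, hwD⟩, z, hz, rfl⟩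
  have hlength : a * w * a⁻¹ ∈ A ^ (2 * m) := Finset.pow_subset_pow_right hone (by omega)
    (conj_mem_pow (j := 1) hA ((pow_one A).symm ▸ ha) hw)
  obtain ⟨v, hv, y, hy, hvy⟩ :=
    hDN ⟨hlength, Subgroup.Normal.conj_mem ‹D.Normal› w hwD a⟩
  refine ⟨v, hv, y * (a * z * a⁻¹),
    N.mul_mem hy (Subgroup.Normal.conj_mem ‹N.Normal› z hz a), ?_⟩
  calc v * (y * (a * z * a⁻¹)) = v * y * (a * z * a⁻¹) := by group
    _ = a * w * a⁻¹ * (a * z * a⁻¹) := by rw [← hvy]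
    _ = a * (w * z) * a⁻¹ := by group

namespace GrowthData

variable {L i m : ℕ} {U : ℕ → Subgroup G} {T Z : Subgroup G} {K R : ℝ} [Z.Normal]

lemma lt_card_image_conjEnd [DecidableEq (AddMonoid.End (Additive Z))]
    (h : GrowthData L U T A K R) (hZi : Z ≤ U i) (hZ : Disjoint Z (U (i + 1)))
    (hfix : Disjoint Z (Subgroup.centralizer (T : Set G))) (hne : Z ≠ ⊥) :
    R < #(A.image (conjEnd Z)) := by
  obtain htriv | hR := h.roots i
  · refine absurd (hfix.eq_bot_of_le fun z hz => ?_) hne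
    refine Subgroup.mem_centralizer_iff.2 fun t _ => ?_
    have ht := layerKernel_le_centralizer (h.normal i) hZi hZ (htriv.ge (Subgroup.mem_top t))
    exact (Subgroup.mem_centralizer_iff.1 ht z hz).symm
  refine hR.trans_le ?_
  rw [← Set.ncard_coe_finset, coe_image]
  refine Nat.cast_le.2 (ncard_image_le_ncard_image A.finite_toSet fun a _ b _ hab => ?_)
  refine QuotientGroup.eq.2 ((h.semiregular i (a⁻¹ * b)).resolve_right fun hg => hne ?_)
  refine eq_bot_iff.2 fun z hz => hg.of_disjoint hZi hZ z hz (Subgroup.mem_bot.2 ?_)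
  exact conjEnd_apply_eq_iff.1 (DFunLike.congr_fun hab (Additive.ofMul ⟨z, hz⟩))

lemma exists_normal_subset_pow (h : GrowthData L U T A K R) [Finite G] {k : ℕ} (hk : 2 ≤ k)
    (hZi : Z ≤ U i) (hZ : Disjoint Z (U (i + 1)))
    (hfix : Disjoint Z (Subgroup.centralizer (T : Set G))) (hR : 2 * K ^ (6 * k + 13) ≤ R) :
    ∃ N : Subgroup G, N.Normal ∧ (∀ x ∈ A ^ k, x ∈ Z → x ∈ N) ∧ ∀ x ∈ N, x ∈ A ^ (12 * k + 24) := by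
  classical
  obtain rfl | hne := eq_or_ne Z ⊥
  · refine ⟨⊥, inferInstance, fun x _ hx => hx, fun x hx => ?_⟩
    rw [Subgroup.mem_bot.1 hx]
    exact Finset.one_mem_pow h.one_mem
  have := h.isMulCommutative hZi hZ
  have hcard := h.lt_card_image_conjEnd hZi hZ hfix hne
  have hK : 1 ≤ K ^ (6 * k + 13) := one_le_pow₀ h.one_le
  refine exists_normal_subset_pow_of_card_wordSlice_lt h.inv_eq h.one_mem h.closure_eq
    (isSemiregularFamily_image_conjEnd (fun a b => h.zero_le_centralizer hZi hZ
      (h.commutator_mem_zero a b)) (fun g => ?_) A)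
    (one_lt_card_iff_nontrivial.1 ?_) (Nat.cast_lt (α := ℝ).1 ?_)
  · exact (h.semiregular i g).imp (fun hg => layerKernel_le_centralizer (h.normal i) hZi hZ hg)
      fun hg => hg.of_disjoint hZi hZ
  · rw [← Nat.one_lt_cast (α := ℝ)]
    linarith
  have hpos : (0 : ℝ) < #(wordSlice A Z k) :=
    Nat.cast_pos.2 (Finset.card_pos.2 ⟨0, zero_mem_wordSlice h.one_mem⟩)
  push_cast
  calc (2 * #(wordSlice A Z (6 * k + 12)) : ℝ)
      ≤ 2 * (K ^ (6 * k + 13) * #(wordSlice A Z k)) := by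
        gcongr
        exact h.card_wordSlice_le hk
    _ ≤ R * #(wordSlice A Z k) := by
        rw [← mul_assoc]
        gcongr
    _ < #(A.image (conjEnd Z)) * #(wordSlice A Z k) := by gcongr
    _ = _ := mul_comm _ _

theorem coveredModulo_bot_of_semiregular (h : GrowthData L U T A K R) [Finite G]
    (hm : commutatorLength (L + 1) ≤ m) (hm2 : 2 ≤ m) (hZD : Z ≤ ⁅U 0, T⁆) (hZi : Z ≤ U i)
    (hZ : Disjoint Z (U (i + 1))) (hfix : Disjoint Z (Subgroup.centralizer (T : Set G)))
    (hR : 2 * K ^ (18 * m + 13) ≤ R) (hcov : CoveredModulo A m ⁅U 0, T⁆ Z) :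
    CoveredModulo A (37 * m + 24) ⁅U 0, T⁆ ⊥ := by
  obtain ⟨N, hN, hAN, hNA⟩ := h.exists_normal_subset_pow (k := 3 * m) (by omega) hZi hZ hfix
    (by rwa [← mul_assoc])
  have hDn := h.commutator_normal
  set D := ⁅U 0, T⁆
  have hDN : ↑(A ^ (2 * m)) ∩ (D : Set G) ⊆ (↑(A ^ m) ∩ (D : Set G)) * (N : Set G) := by
    rintro _ ⟨hlength, hx⟩
    obtain ⟨a, ha, z, hz, rfl⟩ := hcov _ hx
    refine ⟨a, ⟨ha, ?_⟩, z, hAN z ?_ hz, rfl⟩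
    · exact (Subgroup.mul_mem_cancel_right _ (hZD hz)).1 hx
    · have hz' := mul_mem_pow_add (inv_mem_pow h.inv_eq ha) hlength
      rw [inv_mul_cancel_left] at hz'
      convert hz' using 2
      ring
  obtain ⟨B, hB, hBeq⟩ :=
    exists_normal_coe_eq_mul h.inv_eq h.one_mem h.closure_eq hm2 hDN
  have hDB : D ≤ B := h.commutator_le_of_pow_inter_subset hm hB fun x hxA hxD => by
    rw [← SetLike.mem_coe, hBeq]
    exact ⟨x, ⟨hxA, hxD⟩, 1, N.one_mem, mul_one x⟩
  intro x hx
  obtain ⟨w, ⟨hw, -⟩, z, hz, rfl⟩ := hBeq.le (hDB hx)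
  refine ⟨w * z, ?_, 1, Subgroup.one_mem _, mul_one _⟩
  convert mul_mem_pow_add hw (hNA z hz) using 2
  ring

end GrowthData

end Semiregular

section Pairing

lemma sum_sum_pairing {X D : Type*} [Group X] [Group D] [Fintype X] [Fintype D]
    (f : D →* X →* ℂˣ) :
    ∑ y : D, ∑ x : X, (f y x : ℂ) = Nat.card f.ker * Fintype.card X := by
  classical
  have hinner (y : D) : ∑ x : X, (f y x : ℂ) = if y ∈ f.ker then (Fintype.card X : ℂ) else 0 := by
    have hker : (Units.coeHom ℂ).comp (f y) = 1 ↔ y ∈ f.ker := by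
      rw [MonoidHom.mem_ker, ← MonoidHom.comp_one (Units.coeHom ℂ),
        MonoidHom.cancel_left Units.val_injective]
    refine (sum_hom_units ((Units.coeHom ℂ).comp (f y))).trans ?_
    simp only [hker, Nat.cast_ite, Nat.cast_zero]
  rw [Finset.sum_congr rfl fun y _ => hinner y, ← Finset.sum_filter, Finset.sum_const,
    nsmul_eq_mul, Nat.card_eq_fintype_card, Fintype.card_subtype]

lemma ncard_range_mul_norm_sum_sum_pairing {X D : Type*} [Group X] [Group D] [Fintype X]
    [Fintype D] (f : D →* X →* ℂˣ) :
    (Set.range f).ncard * ‖∑ y : D, ∑ x : X, (f y x : ℂ)‖ = Fintype.card D * Fintype.card X := by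
  have hcard : (Set.range f).ncard * Nat.card f.ker = Fintype.card D := by
    rw [← Nat.card_eq_fintype_card, ← f.ker.card_mul_index, Subgroup.index_ker,
      ← Nat.card_coe_set_eq, mul_comm]
    rfl
  rw [sum_sum_pairing, norm_mul, Complex.norm_natCast, Complex.norm_natCast, ← mul_assoc]
  exact_mod_cast congrArg (· * Fintype.card X) hcard

variable {G C : Type*} [Group G] [CommGroup C]

lemma commutatorElement_mul_right_of_commute {x y y' : G} (h : Commute y ⁅x, y'⁆) :
    ⁅x, y * y'⁆ = ⁅x, y⁆ * ⁅x, y'⁆ := by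
  rw [commutatorElement_mul_right_eq_mul_conj, mul_assoc _ y, h.eq, ← mul_assoc,
    mul_inv_cancel_right]

lemma commutatorElement_mul_left_of_commute {x x' y : G} (h : Commute x ⁅x', y⁆) :
    ⁅x * x', y⁆ = ⁅x', y⁆ * ⁅x, y⁆ := by
  rw [commutatorElement_mul_left_eq_conj_mul, h.eq, mul_inv_cancel_right]

variable {X D Z : Subgroup G}

/-- The pairing `(y, x) ↦ ψ ⁅x, y⁆` of `D` with `X` attached to a homomorphism `ψ` from a subgroup
`Z` containing `⁅X, D⁆` and centralized by `X` and `D`. -/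
def commutatorPairing (hXD : ⁅X, D⁆ ≤ Z) (hX : X ≤ Subgroup.centralizer (Z : Set G))
    (hD : D ≤ Subgroup.centralizer (Z : Set G)) (ψ : Z →* C) : D →* X →* C :=
  MonoidHom.mk' (fun y => MonoidHom.mk'
    (fun x => ψ ⟨⁅(x : G), (y : G)⁆, hXD (Subgroup.commutator_mem_commutator x.2 y.2)⟩)
    (fun x x' => by
      rw [mul_comm, ← map_mul]
      refine congrArg ψ (Subtype.ext (commutatorElement_mul_left_of_commute ?_))
      exact (Subgroup.mem_centralizer_iff.1 (hX x.2) _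
        (hXD (Subgroup.commutator_mem_commutator x'.2 y.2))).symm))
    (fun y y' => MonoidHom.ext fun x => by
      simp only [MonoidHom.mul_apply, MonoidHom.mk'_apply]
      rw [← map_mul]
      refine congrArg ψ (Subtype.ext (commutatorElement_mul_right_of_commute ?_))
      exact (Subgroup.mem_centralizer_iff.1 (hD y.2) _
        (hXD (Subgroup.commutator_mem_commutator x.2 y'.2))).symm)

lemma commutatorPairing_ne_one (hXD : ⁅X, D⁆ = Z) (hX : X ≤ Subgroup.centralizer (Z : Set G))
    (hD : D ≤ Subgroup.centralizer (Z : Set G)) {ψ : Z →* C} (hψ : ψ ≠ 1) :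
    commutatorPairing hXD.le hX hD ψ ≠ 1 := by
  refine fun hone => hψ (MonoidHom.ext fun z => ?_)
  have hle : Z ≤ ψ.ker.map Z.subtype := by
    refine hXD.ge.trans (Subgroup.commutator_le.2 fun x hx y hy => ⟨⟨⁅x, y⁆, hXD.le
      (Subgroup.commutator_mem_commutator hx hy)⟩, ?_, rfl⟩)
    exact DFunLike.congr_fun (DFunLike.congr_fun hone ⟨y, hy⟩) ⟨x, hx⟩
  obtain ⟨w, hw, hwz⟩ := hle z.2
  obtain rfl : w = z := Subtype.ext hwz
  exact hw

lemma commutatorPairing_conj [D.Normal] [X.Normal] (hXD : ⁅X, D⁆ ≤ Z)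
    (hX : X ≤ Subgroup.centralizer (Z : Set G)) (hD : D ≤ Subgroup.centralizer (Z : Set G))
    (ψ : Z →* C) {t : G} (ht : t ∈ Subgroup.centralizer (Z : Set G)) (y : D) (x : X) :
    commutatorPairing hXD hX hD ψ (MulAut.conjNormal t y) (MulAut.conjNormal t x) =
      commutatorPairing hXD hX hD ψ y x := by
  refine congrArg ψ (Subtype.ext ?_)
  have hxy := hXD (Subgroup.commutator_mem_commutator x.2 y.2)
  simp only [MulAut.conjNormal_apply]
  rw [← conjugate_commutatorElement, ← Subgroup.mem_centralizer_iff.1 ht _ hxy,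
    mul_inv_cancel_right]

end Pairing

section CharacterLayer

variable {G C : Type*} [Group G] [CommGroup C] {L i : ℕ} {U : ℕ → Subgroup G} {T D : Subgroup G}
  {f : D →* C}

lemma IsLayered.exists_subgroupOf_le_ker (h : IsLayered L U T) (hD : D ≤ U 0) (hf : f ≠ 1) :
    ∃ i, ¬ (U i).subgroupOf D ≤ f.ker ∧ (U (i + 1)).subgroupOf D ≤ f.ker := by
  refine Nat.exists_not_and_succ_of_not_zero_of_exists
    (p := fun i => (U i).subgroupOf D ≤ f.ker) (fun hle => hf ?_) ⟨L, ?_⟩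
  · exact MonoidHom.ext fun x => hle (hD x.2)
  · intro x hx
    rw [h.eq_bot, Subgroup.bot_subgroupOf, Subgroup.mem_bot] at hx
    rw [hx]
    exact f.ker.one_mem

variable [D.Normal] {x : D}

lemma map_conjNormal_eq_iff {g : G} : f (MulAut.conjNormal g x) = f x ↔
    MulAut.conjNormal g x * x⁻¹ ∈ f.ker := by
  rw [MonoidHom.mem_ker, map_mul, map_inv, mul_inv_eq_one]

lemma IsLayered.map_eq_one_of_le_layerKernel (h : IsLayered L U T) [Finite G] (hD : D ≤ U 0)
    (hDT : D ≤ ⁅D, D ⊔ T⁆) (hT : T ≤ layerKernel (U i) (U (i + 1)) (h.normal i))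
    (hf : (U (i + 1)).subgroupOf D ≤ f.ker) (hx : (x : G) ∈ U i) : f x = 1 := by
  have := Fintype.ofFinite T
  have hinner (d : G) (hd : d ∈ D) (m : D) : f (MulAut.conjNormal d m) = f m := by
    have hconj : MulAut.conjNormal d m = (⟨d, hd⟩ : D) * m * (⟨d, hd⟩ : D)⁻¹ :=
      Subtype.ext (by simp)
    rw [hconj, map_mul, map_mul, map_inv, mul_comm, inv_mul_cancel_left]
  have hpow := pow_card_eq_one_of_fixed (T := T) hinner (hDT x.2)
    fun t ht => map_conjNormal_eq_iff.2 (hf (hT ht x hx))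
  rw [← map_pow] at hpow
  refine mem_of_pow_mem_of_coprime_orderOf (N := f.ker) ?_ hpow
  rw [← Subgroup.orderOf_coe]
  exact h.coprime_orderOf (hD x.2)

lemma IsLayered.mem_layerKernel_of_map_conjNormal_eq (h : IsLayered L U T) [Finite G] {t : G}
    (ht : ∀ y : D, f y = 1 → f (MulAut.conjNormal t y) = 1)
    (hf : (U (i + 1)).subgroupOf D ≤ f.ker) (hx : (x : G) ∈ U i) (hfx : f x ≠ 1)
    (htx : f (MulAut.conjNormal t x) = f x) :
    t ∈ layerKernel (U i) (U (i + 1)) (h.normal i) := by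
  have := h.normal (i + 1)
  refine (h.semiregular i t).resolve_right fun hfree => hfx ?_
  set S := f.ker.map D.subtype ⊓ U i
  have hS : ∀ s ∈ S, t * s * t⁻¹ ∈ S := by
    rintro _ ⟨⟨s, hs, rfl⟩, hsi⟩
    exact ⟨⟨_, ht s hs, rfl⟩, (h.normal i).conj_mem _ hsi t⟩
  have htxS : ⁅t, (x : G)⁆ ∈ S :=
    ⟨⟨_, map_conjNormal_eq_iff.1 htx, rfl⟩,
      (U i).mul_mem ((h.normal i).conj_mem _ hx t) ((U i).inv_mem hx)⟩
  have hxS := hfree.sup inf_le_right hS x hx (Subgroup.mem_sup_left htxS)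
  rw [Subgroup.mem_sup_of_normal_right] at hxS
  obtain ⟨_, ⟨⟨s, hs, rfl⟩, -⟩, v, hv, hsv⟩ := hxS
  have hv' : s⁻¹ * x ∈ f.ker := hf (by
    rw [Subgroup.mem_subgroupOf, Subgroup.coe_mul, Subgroup.coe_inv, ← hsv]
    simpa using hv)
  exact (Subgroup.mul_mem_cancel_left _ (f.ker.inv_mem hs)).1 hv'

/-- The orbit under `T` of a point of the first layer on which `f` is nontrivial is large. -/
lemma GrowthData.lt_ncard_range [DecidableEq G] {A : Finset G} {K R : ℝ}
    (h : GrowthData L U T A K R) [Finite G] (hD : D ≤ U 0) (hDT : D ≤ ⁅D, D ⊔ T⁆) (hf : f ≠ 1)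
    (hT : ∀ t ∈ T, ∀ y : D, f y = 1 → f (MulAut.conjNormal t y) = 1) :
    R < (Set.range f).ncard := by
  obtain ⟨i, hi, hi'⟩ := h.exists_subgroupOf_le_ker hD hf
  obtain ⟨x, hx, hfx⟩ := SetLike.not_le_iff_exists.1 hi
  obtain hroot | hroot := h.roots i
  · exact absurd (h.map_eq_one_of_le_layerKernel hD hDT (hroot.ge.trans' le_top) hi' hx) hfx
  choose u hu t ht hut using h.exists_mul_eq
  refine hroot.trans_le (Nat.cast_le.2 ?_)
  refine (ncard_image_le_ncard_image (g := fun a => f (MulAut.conjNormal (t a) x))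
    A.finite_toSet fun a _ b _ hab => QuotientGroup.eq.2 ?_).trans
    (Set.ncard_le_ncard (Set.image_subset_iff.2 fun a _ => ⟨_, rfl⟩) (Set.finite_range f))
  have hτ : (t a)⁻¹ * t b ∈ T := T.mul_mem (T.inv_mem (ht a)) (ht b)
  have hτx : f (MulAut.conjNormal ((t a)⁻¹ * t b) x) = f x := by
    have hinv := hT _ (T.inv_mem (ht a))
      (MulAut.conjNormal (t b) x * (MulAut.conjNormal (t a) x)⁻¹)
      (by rw [map_mul, map_inv, mul_inv_eq_one]; exact hab.symm)
    simp only [map_mul, map_inv, MulAut.inv_apply_self] at hinv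
    rw [map_mul, map_inv, MulAut.mul_apply]
    exact mul_inv_eq_one.1 hinv
  have hdecomp : a⁻¹ * b =
      ((t a)⁻¹ * ((u a)⁻¹ * u b) * (t a)⁻¹⁻¹) * ((t a)⁻¹ * t b) := by
    conv_lhs => rw [hut a, hut b]
    group
  rw [hdecomp]
  refine mul_mem (h.zero_le_layerKernel i ((h.normal 0).conj_mem _ ?_ _))
    (h.mem_layerKernel_of_map_conjNormal_eq (hT _ hτ) hi' hx hfx hτx)
  exact mul_mem (inv_mem (hu a)) (hu b)

end CharacterLayer

section Central

open Finset

variable {G : Type*} [Group G] [DecidableEq G] {A : Finset G} {L m : ℕ} {U : ℕ → Subgroup G}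
  {T D X Z : Subgroup G} {K R : ℝ}

lemma CoveredModulo.commutatorElement_mem_pow (hcov : CoveredModulo A m D Z) (hA : A⁻¹ = A)
    (hZD : Z ≤ D) (hD : D ≤ Subgroup.centralizer (Z : Set G)) {x y : G} (hx : x ∈ D)
    (hy : y ∈ D) : ⁅x, y⁆ ∈ A ^ (4 * m) := by
  obtain ⟨a, ha, z, hz, rfl⟩ := hcov x hx
  obtain ⟨b, hb, w, hw, rfl⟩ := hcov y hy
  have haD : a ∈ D := (Subgroup.mul_mem_cancel_right _ (hZD hz)).1 hx
  have hzb : ⁅z, b * w⁆ = 1 :=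
    commutatorElement_eq_one_iff_mul_comm.2 (Subgroup.mem_centralizer_iff.1 (hD hy) z hz)
  have haw : ⁅a, w⁆ = 1 :=
    commutatorElement_eq_one_iff_mul_comm.2 (Subgroup.mem_centralizer_iff.1 (hD haD) w hw).symm
  rw [commutatorElement_mul_left_of_commute (hzb ▸ Commute.one_right a), hzb, one_mul,
    commutatorElement_mul_right_of_commute (haw ▸ Commute.one_right b), haw, mul_one]
  convert _root_.commutatorElement_mem_pow hA ha hb using 2
  ring

namespace GrowthData

lemma mul_norm_sum_commutatorPairing_le (h : GrowthData L U T A K R) [Finite G] [D.Normal]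
    [X.Normal] [Fintype D] [Fintype X] (hDU : D ≤ U 0) (hDT : D ≤ ⁅D, D ⊔ T⁆) (hXD : ⁅X, D⁆ = Z)
    (hX : X ≤ Subgroup.centralizer (Z : Set G)) (hD : D ≤ Subgroup.centralizer (Z : Set G))
    (hT : T ≤ Subgroup.centralizer (Z : Set G)) {ψ : Z →* ℂˣ} (hψ : ψ ≠ 1) :
    R * ‖∑ y : D, ∑ x : X, (commutatorPairing hXD.le hX hD ψ y x : ℂ)‖ ≤
      Fintype.card D * Fintype.card X := by
  have hrange := h.lt_ncard_range hDU hDT (commutatorPairing_ne_one hXD hX hD hψ)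
    fun t ht y hy => MonoidHom.ext fun x => by
      obtain ⟨x, rfl⟩ := (MulAut.conjNormal t : MulAut X).surjective x
      rw [commutatorPairing_conj hXD.le hX hD ψ (hT ht), hy, MonoidHom.one_apply,
        MonoidHom.one_apply]
  rw [← ncard_range_mul_norm_sum_sum_pairing]
  gcongr

open scoped IsMulCommutative in
lemma card_lt_two_mul_card_wordSlice (h : GrowthData L U T A K R) [Finite G] [D.Normal]
    [X.Normal] [Z.Normal] [IsMulCommutative Z] (hDU : D ≤ U 0) (hDT : D ≤ ⁅D, D ⊔ T⁆)
    (hXD : ⁅X, D⁆ = Z) (hX : X ≤ Subgroup.centralizer (Z : Set G))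
    (hD : D ≤ Subgroup.centralizer (Z : Set G)) (hT : T ≤ Subgroup.centralizer (Z : Set G))
    (hshort : ∀ x ∈ X, ∀ y ∈ D, ⁅x, y⁆ ∈ A ^ (4 * m)) (hR : 2 * K ^ (4 * m + 3) ≤ R) :
    Nat.card (Additive Z) < 2 * #(wordSlice A Z (4 * m + 2)) := by
  have := Fintype.ofFinite (Additive Z)
  have := Fintype.ofFinite D
  have := Fintype.ofFinite X
  classical
  have hK : 1 ≤ K ^ (4 * m + 3) := one_le_pow₀ h.one_le
  have hpos : (wordSlice A Z 2).Nonempty := ⟨0, zero_mem_wordSlice h.one_mem⟩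
  rw [Nat.card_eq_fintype_card]
  refine card_lt_two_mul_card_of_fourier_small (I := D × X) (b := fun i =>
    Additive.ofMul (⟨⁅(i.2 : G), (i.1 : G)⁆, hXD.le
      (Subgroup.commutator_mem_commutator i.2.2 i.1.2)⟩ : Z)) hpos
    (q := R) (by linarith) (fun ψ hψ => ?_) (fun v hv i => ?_) ?_
  · let χ : Z →* ℂˣ :=
      (ψ.toMonoidHom.comp (MulEquiv.multiplicativeAdditive Z).symm.toMonoidHom).toHomUnits
    have hχ : χ ≠ 1 := fun hχ => hψ (DFunLike.ext _ _ fun v =>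
      congrArg Units.val (DFunLike.congr_fun hχ v.toMul))
    have hψχ (i : D × X) : ψ (Additive.ofMul (⟨⁅(i.2 : G), (i.1 : G)⁆, hXD.le
        (Subgroup.commutator_mem_commutator i.2.2 i.1.2)⟩ : Z)) =
          (commutatorPairing hXD.le hX hD χ i.1 i.2 : ℂ) := rfl
    simp only [hψχ]
    rw [Fintype.sum_prod_type, Fintype.card_prod, Nat.cast_mul]
    exact h.mul_norm_sum_commutatorPairing_le hDU hDT hXD hX hD hT hχ
  · rw [add_comm (4 * m)]
    exact add_mem_wordSlice hv (mem_wordSlice.2 (hshort _ i.2.2 _ i.1.2))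
  · have hposR : (0 : ℝ) < #(wordSlice A Z 2) := Nat.cast_pos.2 hpos.card_pos
    calc 2 * (#(wordSlice A Z (4 * m + 2)) : ℝ)
        ≤ 2 * (K ^ (4 * m + 3) * #(wordSlice A Z 2)) := by
          gcongr
          exact h.card_wordSlice_le le_rfl
      _ ≤ R * #(wordSlice A Z 2) := by
          rw [← mul_assoc]
          gcongr
      _ < R ^ 2 * #(wordSlice A Z 2) := by
          gcongr
          nlinarith

theorem coveredModulo_bot_of_central (h : GrowthData L U T A K R) [Finite G] [X.Normal]
    [Z.Normal] (hXD : X ≤ ⁅U 0, T⁆) (hXZ : ⁅X, ⁅U 0, T⁆⁆ = Z)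
    (hZ : ⁅U 0, T⁆ ⊔ T ≤ Subgroup.centralizer (Z : Set G)) (hR : 2 * K ^ (4 * m + 3) ≤ R)
    (hcov : CoveredModulo A m ⁅U 0, T⁆ Z) : CoveredModulo A (9 * m + 4) ⁅U 0, T⁆ ⊥ := by
  have := h.commutator_normal
  have hZD : Z ≤ ⁅U 0, T⁆ := hXZ.ge.trans (Subgroup.commutator_le_right _ _)
  have hDZ := le_sup_left.trans hZ
  have hcomm : IsMulCommutative Z := ⟨⟨fun x y => Subtype.ext <|
    Subgroup.mem_centralizer_iff.1 (hDZ (hZD y.2)) x x.2⟩⟩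
  have hcard := h.card_lt_two_mul_card_wordSlice h.commutator_le_zero
    h.commutator_le_commutator_sup hXZ (hXD.trans hDZ) hDZ (le_sup_right.trans hZ)
    (fun x hx y hy => hcov.commutatorElement_mem_pow h.inv_eq hZD hDZ (hXD hx) hy) hR
  intro _ hx
  obtain ⟨a, ha, z, hz, rfl⟩ := hcov _ hx
  open scoped IsMulCommutative in
  obtain ⟨v, hv, w, hw, hvw⟩ := subset_add_self_of_natCard_lt (V := Additive Z) (H := ⊤)
    (Q := wordSlice A Z (4 * m + 2)) (fun _ _ => AddSubgroup.mem_top _)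
    (by rwa [AddSubgroup.card_top, Set.ncard_coe_finset])
    (AddSubgroup.mem_top (Additive.ofMul ⟨z, hz⟩))
  refine ⟨a * z, ?_, 1, Subgroup.one_mem _, mul_one _⟩
  have hvwA := add_mem_wordSlice hv hw
  rw [show v + w = _ from hvw, mem_wordSlice] at hvwA
  have hlength : 9 * m + 4 = m + (4 * m + 2 + (4 * m + 2)) := by ring
  rw [hlength]
  exact mul_mem_pow_add ha hvwA

end GrowthData

end Central

section Quotient

variable {G : Type*} [Group G] {M D T : Subgroup G}

lemma disjoint_map_mk' {N P V : Subgroup G} [N.Normal] (hNP : N ≤ P) (hPV : P ⊓ V ≤ N) :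
    Disjoint (P.map (QuotientGroup.mk' N)) (V.map (QuotientGroup.mk' N)) := by
  refine Subgroup.disjoint_def.2 ?_
  rintro _ ⟨x, hx, rfl⟩ ⟨v, hv, hvx⟩
  have hxv : v ∈ P :=
    (Subgroup.mul_mem_cancel_left _ (P.inv_mem hx)).1 (hNP (QuotientGroup.eq.1 hvx.symm))
  rw [← hvx]
  exact (QuotientGroup.eq_one_iff v).2 (hPV ⟨hxv, hv⟩)

/-- Coprime action: a fixed point of `T` in `⁅M, D T⁆` has trivial norm over `T`. -/
lemma disjoint_commutator_sup_centralizer [Finite G] [M.Normal] [D.Normal] [IsMulCommutative M]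
    (hMD : M ≤ Subgroup.centralizer (D : Set G)) (hcop : (Nat.card M).Coprime (Nat.card T)) :
    Disjoint ⁅M, D ⊔ T⁆ (Subgroup.centralizer (T : Set G)) := by
  open scoped IsMulCommutative in
  have := Fintype.ofFinite T
  refine Subgroup.disjoint_def.2 fun {x} hx hxT => ?_
  have hxM : x ∈ M := Subgroup.commutator_le_left _ _ hx
  have hpow := pow_card_eq_one_of_fixed (f := MonoidHom.id M) (x := ⟨x, hxM⟩) (T := T) (D := D)
    (fun d hd m => Subtype.ext ?_) hx (fun t ht => Subtype.ext ?_)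
  · refine Subgroup.mem_bot.1 (mem_of_pow_mem_of_coprime_orderOf ?_
      (Subgroup.mem_bot.2 (congrArg Subtype.val hpow)))
    exact (hcop.coprime_dvd_left (M.orderOf_dvd_natCard hxM)).symm
  · rw [MonoidHom.id_apply, MulAut.conjNormal_apply, Subgroup.mem_centralizer_iff.1 (hMD m.2) d hd,
      mul_inv_cancel_right]
    rfl
  · rw [MonoidHom.id_apply, MulAut.conjNormal_apply, Subgroup.mem_centralizer_iff.1 hxT t ht,
      mul_inv_cancel_right]
    rfl

end Quotient

namespace CoveredModulo

variable {G : Type*} [Group G] [DecidableEq G] {A : Finset G} {m : ℕ} {D X Y : Subgroup G}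

lemma mono (h : CoveredModulo A m D X) (hXY : X ≤ Y) : CoveredModulo A m D Y := fun x hx => by
  obtain ⟨a, ha, z, hz, haz⟩ := h x hx
  exact ⟨a, ha, z, hXY hz, haz⟩

lemma mono_length (h : CoveredModulo A m D X) (hA : 1 ∈ A) {k : ℕ} (hmk : m ≤ k) :
    CoveredModulo A k D X := fun x hx => by
  obtain ⟨a, ha, z, hz, haz⟩ := h x hx
  exact ⟨a, Finset.pow_subset_pow_right hA hmk ha, z, hz, haz⟩

lemma map (h : CoveredModulo A m D X) {H : Type*} [Group H] [DecidableEq H] (f : G →* H) :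
    CoveredModulo (A.image f) m (D.map f) (X.map f) := by
  rintro _ ⟨x, hx, rfl⟩
  obtain ⟨a, ha, z, hz, rfl⟩ := h x hx
  refine ⟨f a, ?_, f z, Subgroup.mem_map_of_mem f hz, (map_mul f a z).symm⟩
  rw [← Finset.image_pow]
  exact Finset.mem_image_of_mem f ha

lemma of_map_mk' [Y.Normal] [DecidableEq (G ⧸ Y)]
    (h : CoveredModulo (A.image (QuotientGroup.mk' Y)) m (D.map (QuotientGroup.mk' Y)) ⊥) :
    CoveredModulo A m D Y := by
  intro x hx
  obtain ⟨_, hb, _, rfl, hbx⟩ := h _ (Subgroup.mem_map_of_mem _ hx)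
  rw [← Finset.image_pow] at hb
  obtain ⟨a, ha, rfl⟩ := Finset.mem_image.1 hb
  rw [mul_one] at hbx
  exact ⟨a, ha, a⁻¹ * x, QuotientGroup.eq.1 hbx, mul_inv_cancel_left a x⟩

end CoveredModulo

section Descent

variable {G : Type*} [Group G] {L : ℕ} {U : ℕ → Subgroup G} {T : Subgroup G}

lemma IsLayered.lowerCentralSeries_commutator_le (h : IsLayered L U T) (k : ℕ) :
    (⁅U 0, T⁆).lowerCentralSeries k ≤ U k := by
  induction k with
  | zero => exact h.commutator_le_zero
  | succ k ih => exact (Subgroup.commutator_mono ih h.commutator_le_zero).trans (h.commutator_le k)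

/-- The word length that suffices to pass below one more factor of the descent, given that words of
length `m` suffice above it. -/
def descentStep (m : ℕ) : ℕ := 37 * m + 24

lemma monotone_iterate_descentStep (m : ℕ) : Monotone fun j => descentStep^[j] m := by
  refine Monotone.monotone_iterate_of_le_map (fun a b hab => ?_) ?_ <;> unfold descentStep <;> omega

lemma le_iterate_descentStep (j m : ℕ) : m ≤ descentStep^[j] m :=
  monotone_iterate_descentStep m (Nat.zero_le j)

lemma IsLayered.disjoint_map_centralizer (h : IsLayered L U T) [Finite G] {M Y : Subgroup G}
    [M.Normal] [Y.Normal] (hMD : M ≤ ⁅U 0, T⁆) (hMY : ⁅M, ⁅U 0, T⁆⁆ ≤ Y) :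
    Disjoint ((⁅M, ⁅U 0, T⁆ ⊔ T⁆).map (QuotientGroup.mk' Y))
      (Subgroup.centralizer (T.map (QuotientGroup.mk' Y) : Set (G ⧸ Y))) := by
  have hsurj := QuotientGroup.mk'_surjective Y
  have hMn : (M.map (QuotientGroup.mk' Y)).Normal := .map inferInstance _ hsurj
  have hDn := h.commutator_normal.map _ hsurj
  have hcentral := commutator_le_iff_map_le_centralizer.1 hMY
  have hcomm : IsMulCommutative (M.map (QuotientGroup.mk' Y)) := ⟨⟨fun x y => Subtype.ext <|
    Subgroup.mem_centralizer_iff.1 (hcentral y.2) x (Subgroup.map_mono hMD x.2)⟩⟩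
  rw [Subgroup.map_commutator, Subgroup.map_sup]
  exact disjoint_commutator_sup_centralizer hcentral ((h.map _ hsurj).coprime.coprime_dvd_left
    (Subgroup.card_dvd_of_le (Subgroup.map_mono (hMD.trans h.commutator_le_zero))))

namespace GrowthData

variable [Finite G] [DecidableEq G] {A : Finset G} {K R : ℝ} {M X Y Z : Subgroup G} {i m : ℕ}

lemma coveredModulo_of_central (h : GrowthData L U T A K R) [X.Normal] [Z.Normal] [Y.Normal]
    (hXD : X ≤ ⁅U 0, T⁆) (hXZ : ⁅X, ⁅U 0, T⁆⁆ = Z) (hZY : ⁅Z, ⁅U 0, T⁆ ⊔ T⁆ ≤ Y)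
    (hR : 2 * K ^ (12 * m + 9) ≤ R) (hcov : CoveredModulo A m ⁅U 0, T⁆ Z) :
    CoveredModulo A (9 * m + 4) ⁅U 0, T⁆ Y := by
  classical
  set π := QuotientGroup.mk' Y with hπ
  have hsurj : Function.Surjective π := QuotientGroup.mk'_surjective Y
  have hXn : (X.map π).Normal := .map inferInstance π hsurj
  have hZn : (Z.map π).Normal := .map inferInstance π hsurj
  have hmapD : (⁅U 0, T⁆).map π = ⁅(U 0).map π, T.map π⁆ := Subgroup.map_commutator _ _ π
  have hmapO : (⁅U 0, T⁆ ⊔ T).map π = ⁅(U 0).map π, T.map π⁆ ⊔ T.map π := by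
    rw [Subgroup.map_sup, hmapD]
  have hcentral : (⁅U 0, T⁆ ⊔ T).map π ≤ Subgroup.centralizer (Z.map π : Set (G ⧸ Y)) :=
    commutator_le_iff_map_le_centralizer.1 ((Subgroup.commutator_comm _ _).trans_le hZY)
  have hmapXZ : ⁅X.map π, (⁅U 0, T⁆).map π⁆ = Z.map π := by rw [← Subgroup.map_commutator, hXZ]
  have hcovπ := hcov.map π
  rw [hmapD] at hcovπ hmapXZ
  rw [hmapO] at hcentral
  have hRπ : 2 * (K ^ 3) ^ (4 * m + 3) ≤ R := by
    rw [← pow_mul]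
    exact h.two_mul_pow_le (by omega) hR
  have hbot := (h.quotient Y).coveredModulo_bot_of_central (hmapD ▸ Subgroup.map_mono hXD) hmapXZ
    hcentral hRπ hcovπ
  rw [← hπ, ← hmapD] at hbot
  exact hbot.of_map_mk'

lemma coveredModulo_of_semiregular (h : GrowthData L U T A K R) [M.Normal] (hMD : M ≤ ⁅U 0, T⁆)
    (hm : commutatorLength (L + 1) ≤ m) (hm2 : 2 ≤ m) (hR : 2 * K ^ (54 * m + 39) ≤ R)
    (hcov : CoveredModulo A m ⁅U 0, T⁆ (⁅M, ⁅U 0, T⁆ ⊔ T⁆ ⊓ U i ⊔ ⁅M, ⁅U 0, T⁆⁆)) :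
    CoveredModulo A (descentStep m) ⁅U 0, T⁆
      (⁅M, ⁅U 0, T⁆ ⊔ T⁆ ⊓ U (i + 1) ⊔ ⁅M, ⁅U 0, T⁆⁆) := by
  classical
  have := h.commutator_normal
  have := h.sup_normal
  have := h.normal i
  have := h.normal (i + 1)
  have hfixed (Y : Subgroup G) [Y.Normal] := h.disjoint_map_centralizer (Y := Y) hMD
  have hYP : ⁅M, ⁅U 0, T⁆ ⊔ T⁆ ⊓ U (i + 1) ⊔ ⁅M, ⁅U 0, T⁆⁆ ≤ ⁅M, ⁅U 0, T⁆ ⊔ T⁆ :=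
    sup_le inf_le_left (Subgroup.commutator_mono le_rfl le_sup_left)
  have hPD : ⁅M, ⁅U 0, T⁆ ⊔ T⁆ ≤ ⁅U 0, T⁆ := (Subgroup.commutator_le_left _ _).trans hMD
  set P := ⁅M, ⁅U 0, T⁆ ⊔ T⁆
  set Y := P ⊓ U (i + 1) ⊔ ⁅M, ⁅U 0, T⁆⁆
  set π := QuotientGroup.mk' Y with hπ
  have hZn : ((P ⊓ U i).map π).Normal := .map inferInstance π (QuotientGroup.mk'_surjective Y)
  have hmapD : (⁅U 0, T⁆).map π = ⁅(U 0).map π, T.map π⁆ := Subgroup.map_commutator _ _ π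
  have hmapZ : (P ⊓ U i ⊔ ⁅M, ⁅U 0, T⁆⁆).map π = (P ⊓ U i).map π := by
    rw [Subgroup.map_sup, sup_eq_left, (Subgroup.map_eq_bot_iff _).2]
    · exact bot_le
    · exact (QuotientGroup.ker_mk' Y).ge.trans' le_sup_right
  have hcovπ := hcov.map π
  rw [hmapD, hmapZ] at hcovπ
  have hRπ : 2 * (K ^ 3) ^ (18 * m + 13) ≤ R := by
    rw [← pow_mul]
    exact h.two_mul_pow_le (by omega) hR
  have hbot := (h.quotient Y).coveredModulo_bot_of_semiregular (i := i) hm hm2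
    (hmapD ▸ Subgroup.map_mono (inf_le_left.trans hPD)) (Subgroup.map_mono inf_le_right)
    ((disjoint_map_mk' hYP le_sup_left).mono_left (Subgroup.map_mono inf_le_left))
    ((hfixed Y le_sup_right).mono_left (Subgroup.map_mono inf_le_left)) hRπ hcovπ
  rw [← hπ, ← hmapD] at hbot
  exact hbot.of_map_mk'

lemma coveredModulo_commutator (h : GrowthData L U T A K R) [M.Normal] (hMD : M ≤ ⁅U 0, T⁆)
    (hm : commutatorLength (L + 1) ≤ m) (hm2 : 2 ≤ m)
    (hR : 2 * K ^ (54 * descentStep^[L] m + 39) ≤ R)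
    (hcov : CoveredModulo A m ⁅U 0, T⁆ ⁅M, ⁅U 0, T⁆ ⊔ T⁆) :
    CoveredModulo A (descentStep^[L] m) ⁅U 0, T⁆ ⁅M, ⁅U 0, T⁆⁆ := by
  have hlayer (i : ℕ) (hi : i ≤ L) : CoveredModulo A (descentStep^[i] m) ⁅U 0, T⁆
      (⁅M, ⁅U 0, T⁆ ⊔ T⁆ ⊓ U i ⊔ ⁅M, ⁅U 0, T⁆⁆) := by
    induction i with
    | zero =>
      refine hcov.mono (le_sup_of_le_left (le_inf le_rfl ?_))
      exact (Subgroup.commutator_le_left _ _).trans (hMD.trans h.commutator_le_zero)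
    | succ i ih =>
      have hmi := le_iterate_descentStep i m
      have hiL := monotone_iterate_descentStep m (Nat.le_of_succ_le hi)
      rw [Function.iterate_succ_apply']
      exact h.coveredModulo_of_semiregular hMD (hm.trans hmi) (hm2.trans hmi)
        (h.two_mul_pow_le (by dsimp only at hiL; omega) hR) (ih (Nat.le_of_succ_le hi))
  simpa only [h.eq_bot, inf_bot_eq, bot_sup_eq] using hlayer L le_rfl

lemma coveredModulo_commutator_commutator_sup (h : GrowthData L U T A K R) [M.Normal]
    (hMD : M ≤ ⁅U 0, T⁆) (hm : commutatorLength (L + 1) ≤ m) (hm2 : 2 ≤ m)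
    (hR : 2 * K ^ (54 * descentStep^[L] m + 39) ≤ R)
    (hcov : CoveredModulo A m ⁅U 0, T⁆ ⁅M, ⁅U 0, T⁆ ⊔ T⁆) :
    CoveredModulo A (descentStep^[L + 1] m) ⁅U 0, T⁆ ⁅⁅M, ⁅U 0, T⁆⁆, ⁅U 0, T⁆ ⊔ T⁆ := by
  have := h.commutator_normal
  have := h.sup_normal
  rw [Function.iterate_succ_apply']
  exact (h.coveredModulo_of_central hMD rfl le_rfl (h.two_mul_pow_le (by omega) hR)
    (h.coveredModulo_commutator hMD hm hm2 hR hcov)).mono_length h.one_mem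
      (by unfold descentStep; omega)

lemma coveredModulo_lowerCentralSeries (h : GrowthData L U T A K R)
    (hm : commutatorLength (L + 1) ≤ m) (hm2 : 2 ≤ m) (k : ℕ)
    (hR : 2 * K ^ (54 * descentStep^[(L + 1) * k] m + 39) ≤ R) :
    CoveredModulo A (descentStep^[(L + 1) * k] m) ⁅U 0, T⁆
      ⁅(⁅U 0, T⁆).lowerCentralSeries k, ⁅U 0, T⁆ ⊔ T⁆ := by
  have := h.commutator_normal
  induction k with
  | zero =>
    exact fun x hx =>
      ⟨1, Finset.one_mem_pow h.one_mem, x, h.commutator_le_commutator_sup hx, one_mul x⟩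
  | succ k ih =>
    have hk := Subgroup.lowerCentralSeries_normal (S := ⁅U 0, T⁆) k
    have hmk := le_iterate_descentStep ((L + 1) * k) m
    have hstep : descentStep^[(L + 1) * (k + 1)] m =
        descentStep^[L + 1] (descentStep^[(L + 1) * k] m) := by
      rw [← Function.iterate_add_apply, mul_add_one, add_comm]
    have hL := monotone_iterate_descentStep (descentStep^[(L + 1) * k] m) (Nat.le_add_right L 1)
    have hle := le_iterate_descentStep (L + 1) (descentStep^[(L + 1) * k] m)
    dsimp only at hL
    rw [hstep] at hR ⊢
    exact h.coveredModulo_commutator_commutator_sup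
      ((⁅U 0, T⁆).lowerCentralSeries_antitone (Nat.zero_le k)) (hm.trans hmk) (hm2.trans hmk)
      (h.two_mul_pow_le (by omega) hR) (ih (h.two_mul_pow_le (by omega) hR))

theorem commutator_subset_pow (h : GrowthData L U T A K R) (hm : commutatorLength (L + 1) ≤ m)
    (hm2 : 2 ≤ m) (hR : 2 * K ^ (54 * descentStep^[(L + 1) * L] m + 39) ≤ R) :
    ((⁅U 0, T⁆ : Subgroup G) : Set G) ⊆ ↑(A ^ descentStep^[(L + 1) * L] m) := by
  have := h.commutator_normal
  have hbot : ⁅(⁅U 0, T⁆).lowerCentralSeries L, ⁅U 0, T⁆ ⊔ T⁆ = ⊥ := by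
    have := Subgroup.lowerCentralSeries_normal (S := ⁅U 0, T⁆) L
    rw [← le_bot_iff, ← h.eq_bot]
    exact (Subgroup.commutator_le_left _ _).trans (h.lowerCentralSeries_commutator_le L)
  intro x hx
  obtain ⟨a, ha, z, hz, rfl⟩ := h.coveredModulo_lowerCentralSeries hm hm2 L hR x hx
  rw [hbot, Subgroup.mem_bot] at hz
  rwa [hz, mul_one]

end GrowthData

end Descent

section Triangular

variable {n : ℕ} {E : Type*} [Ring E]

/-- The position of the matrix entry `(r, s)` in the enumeration of the entries above the diagonal
by diagonals; entries on or below the diagonal have position less than `n`. -/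
def entryIndex (r s : Fin n) : ℕ := ((s : ℕ) - r) * n + r

lemma entryIndex_lt_of_lt_left {r t s : Fin n} {i : ℕ} (hrt : r < t)
    (h : entryIndex r s ≤ i + n) : entryIndex t s < i + n := by
  unfold entryIndex at *
  have := t.2
  have : (r : ℕ) < t := hrt
  rcases le_or_gt (t : ℕ) s with hts | hts
  · obtain ⟨d, hd⟩ : ∃ d, (s : ℕ) - r = (s - t) + 1 + d := ⟨t - r - 1, by omega⟩
    rw [hd] at h
    have : ((s : ℕ) - t + 1 + d) * n = (s - t) * n + n + d * n := by ring
    have := Nat.zero_le (d * n)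
    omega
  · rw [Nat.sub_eq_zero_of_le hts.le]
    omega

lemma entryIndex_le_of_le_right {r t s : Fin n} (hts : t ≤ s) :
    entryIndex r t ≤ entryIndex r s := by
  unfold entryIndex
  have hts' : (t : ℕ) ≤ s := hts
  gcongr

lemma entryIndex_lt_of_lt_right {r t s : Fin n} {i : ℕ} (hts : t < s)
    (h : entryIndex r s = i + n) : entryIndex r t < i + n := by
  unfold entryIndex at *
  have hts' : (t : ℕ) < s := hts
  have hr := r.2
  have hn : 0 < n := by omega
  rcases le_or_gt (s : ℕ) r with hsr | hsr
  · rw [Nat.sub_eq_zero_of_le hsr] at h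
    omega
  · rw [← h]
    have : (t : ℕ) - r < s - r := by omega
    have := Nat.mul_lt_mul_of_pos_right this hn
    omega

lemma eq_of_entryIndex_eq {r s r' s' : Fin n} {i : ℕ} (h : entryIndex r s = i + n)
    (h' : entryIndex r' s' = i + n) : r = r' ∧ s = s' := by
  unfold entryIndex at *
  have hr := r.2
  have hr' := r'.2
  have hn : 0 < n := by omega
  have e1 : (r : ℕ) = (i + n) % n := by
    rw [← h, add_comm, Nat.add_mul_mod_self_right, Nat.mod_eq_of_lt hr]
  have e2 : (r' : ℕ) = (i + n) % n := by
    rw [← h', add_comm, Nat.add_mul_mod_self_right, Nat.mod_eq_of_lt hr']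
  have err : (r : ℕ) = r' := e1.trans e2.symm
  have hmul : ((s : ℕ) - r) * n = (s' - r') * n := by omega
  have hsub := Nat.eq_of_mul_eq_mul_right hn hmul
  have hpos : (s : ℕ) - r ≠ 0 := by
    intro h0
    rw [h0] at h
    omega
  exact ⟨Fin.ext err, Fin.ext (by omega)⟩

/-- The matrices supported on the entries of position at least `i + n`. -/
def triangularIdeal (n : ℕ) (E : Type*) [Ring E] (i : ℕ) :
    AddSubgroup (Matrix (Fin n) (Fin n) E) where
  carrier := {N | ∀ r s, entryIndex r s < i + n → N r s = 0}
  zero_mem' := by intro r s _; rfl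
  add_mem' := by
    intro a b ha hb r s h
    rw [Matrix.add_apply, ha r s h, hb r s h, add_zero]
  neg_mem' := by
    intro a ha r s h
    rw [Matrix.neg_apply, ha r s h, neg_zero]

lemma triangularIdeal_antitone : Antitone (triangularIdeal n E) :=
  fun i j hij _ hN r s h => hN r s (h.trans_le (by omega))

lemma mul_mem_triangularIdeal_left {a N : Matrix (Fin n) (Fin n) E} {i : ℕ}
    (ha : a.BlockTriangular id) (hN : N ∈ triangularIdeal n E i) :
    a * N ∈ triangularIdeal n E i := by
  intro r s h
  rw [Matrix.mul_apply]
  refine Finset.sum_eq_zero fun t _ => ?_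
  rcases lt_trichotomy t r with htr | rfl | hrt
  · rw [ha htr, zero_mul]
  · rw [hN t s h, mul_zero]
  · rw [hN t s (entryIndex_lt_of_lt_left hrt h.le), mul_zero]

lemma mul_mem_triangularIdeal_right {a N : Matrix (Fin n) (Fin n) E} {i : ℕ}
    (ha : a.BlockTriangular id) (hN : N ∈ triangularIdeal n E i) :
    N * a ∈ triangularIdeal n E i := by
  intro r s h
  rw [Matrix.mul_apply]
  refine Finset.sum_eq_zero fun t _ => ?_
  rcases le_or_gt t s with hts | hts
  · rw [hN r t ((entryIndex_le_of_le_right hts).trans_lt h), zero_mul]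
  · rw [ha hts, mul_zero]

lemma mul_apply_of_entryIndex_eq_left {a N : Matrix (Fin n) (Fin n) E} {i : ℕ} {r s : Fin n}
    (ha : a.BlockTriangular id) (hN : N ∈ triangularIdeal n E i) (h : entryIndex r s = i + n) :
    (a * N) r s = a r r * N r s := by
  rw [Matrix.mul_apply]
  refine Finset.sum_eq_single r (fun t _ htr => ?_) (by simp)
  rcases lt_or_gt_of_ne htr with htr | hrt
  · rw [ha htr, zero_mul]
  · rw [hN t s (entryIndex_lt_of_lt_left hrt h.le), mul_zero]

lemma mul_apply_of_entryIndex_eq_right {a N : Matrix (Fin n) (Fin n) E} {i : ℕ} {r s : Fin n}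
    (ha : a.BlockTriangular id) (hN : N ∈ triangularIdeal n E i) (h : entryIndex r s = i + n) :
    (N * a) r s = N r s * a s s := by
  rw [Matrix.mul_apply]
  refine Finset.sum_eq_single s (fun t _ hts => ?_) (by simp)
  rcases lt_or_gt_of_ne hts with hts | hst
  · rw [hN r t (entryIndex_lt_of_lt_right hts h), zero_mul]
  · rw [ha hst, mul_zero]

lemma add_le_of_apply_ne_zero {N : Matrix (Fin n) (Fin n) E} {i : ℕ}
    (hN : N ∈ triangularIdeal n E i) {r s : Fin n} (h : N r s ≠ 0) :
    (r : ℕ) + (i / n + 1) ≤ s := by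
  have h1 : i + n ≤ entryIndex r s := by
    by_contra! hlt
    exact h (hN r s hlt)
  unfold entryIndex at h1
  have hr := r.2
  have hn : 0 < n := by omega
  have h2 : i / n + 1 ≤ (s : ℕ) - r := by
    rw [← Nat.add_div_right i hn]
    have := Nat.div_le_div_right (c := n) h1
    rwa [add_comm (((s : ℕ) - r) * n), Nat.add_mul_div_right _ _ hn, Nat.div_eq_of_lt hr,
      zero_add] at this
  generalize i / n = q at h2 ⊢
  omega

lemma mem_triangularIdeal_mul_of_forall {N : Matrix (Fin n) (Fin n) E} {j : ℕ}
    (h : ∀ r s : Fin n, N r s ≠ 0 → (r : ℕ) + (j + 1) ≤ s) : N ∈ triangularIdeal n E (n * j) := by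
  intro r s hrs
  by_contra hne
  have h1 := h r s hne
  unfold entryIndex at hrs
  have h2 : j + 1 ≤ (s : ℕ) - r := by omega
  have h3 := Nat.mul_le_mul_right n h2
  have : (j + 1) * n = n * j + n := by ring
  omega

lemma mul_mem_triangularIdeal {N N' : Matrix (Fin n) (Fin n) E} {i j : ℕ}
    (hN : N ∈ triangularIdeal n E i) (hN' : N' ∈ triangularIdeal n E j) :
    N * N' ∈ triangularIdeal n E (n * (i / n + j / n + 1)) := by
  refine mem_triangularIdeal_mul_of_forall fun r s h => ?_
  rw [Matrix.mul_apply] at h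
  obtain ⟨t, -, ht⟩ := Finset.exists_ne_zero_of_sum_ne_zero h
  have h1 := add_le_of_apply_ne_zero hN (left_ne_zero_of_mul ht)
  have h2 := add_le_of_apply_ne_zero hN' (right_ne_zero_of_mul ht)
  omega

lemma eq_zero_of_mem_triangularIdeal {N : Matrix (Fin n) (Fin n) E}
    (hN : N ∈ triangularIdeal n E (n * n - n)) : N = 0 := by
  ext r s
  by_contra hne
  have h := add_le_of_apply_ne_zero hN hne
  have := r.2
  have := s.2
  have hn : 0 < n := by omega
  have : (n * n - n) / n = n - 1 := by
    rw [← Nat.mul_sub_one, Nat.mul_div_cancel_left _ hn]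
  omega

lemma mem_triangularIdeal_succ_iff {N : Matrix (Fin n) (Fin n) E} {i : ℕ}
    (hN : N ∈ triangularIdeal n E i) :
    N ∈ triangularIdeal n E (i + 1) ↔ ∀ r s, entryIndex r s = i + n → N r s = 0 := by
  refine ⟨fun h r s hrs => h r s (by omega), fun h r s hrs => ?_⟩
  rcases Nat.lt_or_ge (entryIndex r s) (i + n) with hlt | hge
  · exact hN r s hlt
  · exact h r s (by omega)

lemma pow_succ_mem_triangularIdeal {N : Matrix (Fin n) (Fin n) E}
    (hN : N ∈ triangularIdeal n E 0) (k : ℕ) : N ^ (k + 1) ∈ triangularIdeal n E (n * k) := by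
  rcases n.eq_zero_or_pos with rfl | hn
  · exact fun r => r.elim0
  induction k with
  | zero => simpa only [zero_add, pow_one, mul_zero] using hN
  | succ k ih =>
    have h := mul_mem_triangularIdeal ih hN
    rwa [Nat.mul_div_cancel_left _ hn, Nat.zero_div, add_zero, ← pow_succ] at h

lemma pow_eq_zero_of_mem_triangularIdeal {N : Matrix (Fin n) (Fin n) E}
    (hN : N ∈ triangularIdeal n E 0) : N ^ n = 0 := by
  rcases n with _ | n
  · exact Subsingleton.elim _ _
  · refine eq_zero_of_mem_triangularIdeal ?_
    rw [← Nat.mul_sub_one]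
    exact pow_succ_mem_triangularIdeal hN n

end Triangular

/-- A faithful representation of a group by upper triangular matrices. -/
structure IsTriangularRep {n : ℕ} {E : Type*} [CommRing E] {H : Type*} [Group H]
    (ρ : H →* Matrix (Fin n) (Fin n) E) : Prop where
  injective : Function.Injective ρ
  triangular : ∀ h, (ρ h).BlockTriangular id

namespace IsTriangularRep

variable {n : ℕ} {E : Type*} [CommRing E] {H : Type*} [Group H]
  {ρ : H →* Matrix (Fin n) (Fin n) E}

/-- The unipotent subgroup of those `h` for which `ρ h - 1` lies in the `i`-th triangular ideal. -/
def filtration (hρ : IsTriangularRep ρ) (i : ℕ) : Subgroup H where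
  carrier := {h | ρ h - 1 ∈ triangularIdeal n E i}
  one_mem' := by
    change ρ 1 - 1 ∈ triangularIdeal n E i
    rw [map_one, sub_self]
    exact zero_mem _
  mul_mem' := by
    intro x y hx hy
    change ρ (x * y) - 1 ∈ triangularIdeal n E i
    have : ρ (x * y) - 1 = (ρ x - 1) * ρ y + (ρ y - 1) := by rw [map_mul]; noncomm_ring
    rw [this]
    exact add_mem (mul_mem_triangularIdeal_right (hρ.triangular y) hx) hy
  inv_mem' := by
    intro x hx
    change ρ x⁻¹ - 1 ∈ triangularIdeal n E i
    have : ρ x⁻¹ - 1 = -(ρ x⁻¹ * (ρ x - 1)) := by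
      rw [mul_sub, ← map_mul, inv_mul_cancel, map_one]; noncomm_ring
    rw [this]
    exact neg_mem (mul_mem_triangularIdeal_left (hρ.triangular _) hx)

lemma mem_filtration (hρ : IsTriangularRep ρ) {i : ℕ} {h : H} :
    h ∈ hρ.filtration i ↔ ρ h - 1 ∈ triangularIdeal n E i := Iff.rfl

lemma filtration_normal (hρ : IsTriangularRep ρ) (i : ℕ) : (hρ.filtration i).Normal where
  conj_mem x hx g := by
    rw [mem_filtration] at *
    have : ρ (g * x * g⁻¹) - 1 = ρ g * (ρ x - 1) * ρ g⁻¹ := by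
      have h1 : ρ g * ρ g⁻¹ = 1 := by rw [← map_mul, mul_inv_cancel, map_one]
      rw [map_mul, map_mul, mul_sub, sub_mul, mul_one, h1]
    rw [this]
    exact mul_mem_triangularIdeal_right (hρ.triangular _)
      (mul_mem_triangularIdeal_left (hρ.triangular _) hx)

lemma filtration_antitone (hρ : IsTriangularRep ρ) : Antitone hρ.filtration :=
  fun _ _ hij _ hx => triangularIdeal_antitone hij hx

lemma filtration_eq_bot (hρ : IsTriangularRep ρ) : hρ.filtration (n * n - n) = ⊥ := by
  rw [eq_bot_iff]
  intro x hx
  have h1 := eq_zero_of_mem_triangularIdeal hx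
  rw [sub_eq_zero, ← map_one ρ] at h1
  exact Subgroup.mem_bot.2 (hρ.injective h1)

lemma map_commutator_sub_one (x y : H) :
    ρ ⁅x, y⁆ - 1 = ((ρ x - 1) * (ρ y - 1) - (ρ y - 1) * (ρ x - 1)) * ρ (x⁻¹ * y⁻¹) := by
  have h1 : ρ y * ρ x * ρ (x⁻¹ * y⁻¹) = 1 := by
    rw [← map_mul, ← map_mul, ← map_one ρ]
    congr 1
    group
  have h2 : ρ ⁅x, y⁆ = ρ x * ρ y * ρ (x⁻¹ * y⁻¹) := by
    rw [← map_mul, ← map_mul, commutatorElement_def]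
    congr 1
    group
  have h3 : (ρ x - 1) * (ρ y - 1) - (ρ y - 1) * (ρ x - 1) = ρ x * ρ y - ρ y * ρ x := by
    noncomm_ring
  rw [h2, h3, sub_mul, h1]

lemma commutator_filtration_le (hρ : IsTriangularRep ρ) (i : ℕ) :
    ⁅hρ.filtration i, hρ.filtration 0⁆ ≤ hρ.filtration (n * (i / n + 1)) := by
  refine Subgroup.commutator_le.2 fun x hx y hy => ?_
  rw [mem_filtration, map_commutator_sub_one]
  refine mul_mem_triangularIdeal_right (hρ.triangular _) (sub_mem ?_ ?_)
  · simpa using mul_mem_triangularIdeal hx hy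
  · simpa using mul_mem_triangularIdeal hy hx

lemma commutator_filtration_le_succ (hρ : IsTriangularRep ρ) (i : ℕ) :
    ⁅hρ.filtration i, hρ.filtration 0⁆ ≤ hρ.filtration (i + 1) := by
  rcases Nat.eq_zero_or_pos n with rfl | hn
  · have : hρ.filtration (i + 1) = ⊤ := by
      rw [eq_top_iff]
      intro x _ r
      exact r.elim0
    rw [this]
    exact le_top
  · refine (hρ.commutator_filtration_le i).trans (hρ.filtration_antitone ?_)
    rw [mul_add, mul_one]
    have := Nat.lt_mul_div_succ i hn
    rwa [mul_add, mul_one] at this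

lemma diag_mul (hρ : IsTriangularRep ρ) (x y : H) (r : Fin n) :
    ρ (x * y) r r = ρ x r r * ρ y r r := by
  rw [map_mul, Matrix.mul_apply]
  refine Finset.sum_eq_single r (fun t _ htr => ?_) (by simp)
  rcases lt_or_gt_of_ne htr with h | h
  · rw [hρ.triangular x h, zero_mul]
  · rw [hρ.triangular y h, mul_zero]

/-- The homomorphism sending `h` to the diagonal of `ρ h`. -/
def diag (hρ : IsTriangularRep ρ) : H →* (Fin n → E) where
  toFun h r := ρ h r r
  map_one' := by
    funext r
    simp
  map_mul' x y := funext fun r => hρ.diag_mul x y r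

lemma mem_filtration_zero (hρ : IsTriangularRep ρ) {h : H} :
    h ∈ hρ.filtration 0 ↔ hρ.diag h = 1 := by
  rw [mem_filtration]
  constructor
  · intro hh
    funext r
    have := hh r r (by simp [entryIndex])
    rw [Matrix.sub_apply, Matrix.one_apply_eq, sub_eq_zero] at this
    exact this
  · intro hh r s hrs
    have hsr : s ≤ r := by
      by_contra! hlt
      have : (r : ℕ) < s := hlt
      have h1 : 1 ≤ (s : ℕ) - r := by omega
      have h2 := Nat.mul_le_mul_right n h1
      unfold entryIndex at hrs
      omega
    rcases hsr.lt_or_eq with h1 | rfl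
    · rw [Matrix.sub_apply, hρ.triangular h h1, Matrix.one_apply_ne h1.ne', sub_zero]
    · rw [Matrix.sub_apply, Matrix.one_apply_eq, sub_eq_zero]
      exact congrFun hh s

lemma map_commutator_sub_one_apply (hρ : IsTriangularRep ρ) {i : ℕ} {g x : H}
    (hx : x ∈ hρ.filtration i) {r s : Fin n} (hrs : entryIndex r s = i + n) :
    (ρ ⁅g, x⁆ - 1) r s = (ρ g r r * ρ g⁻¹ s s - 1) * (ρ x - 1) r s := by
  have hxs : ρ x⁻¹ s s = 1 := by
    have hx0 := inv_mem (hρ.filtration_antitone i.zero_le hx)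
    exact congrFun (hρ.mem_filtration_zero.1 hx0) s
  have hcomm : ρ ⁅g, x⁆ - 1 = (ρ g * (ρ x - 1) * ρ g⁻¹ - (ρ x - 1)) * ρ x⁻¹ := by
    have hg1 : ρ g * ρ g⁻¹ = 1 := by rw [← map_mul, mul_inv_cancel, map_one]
    have hx1 : ρ x * ρ x⁻¹ = 1 := by rw [← map_mul, mul_inv_cancel, map_one]
    rw [mul_sub, sub_mul _ _ (ρ g⁻¹), mul_one, hg1, commutatorElement_def, map_mul, map_mul,
      map_mul, sub_sub_sub_cancel_right, sub_mul, hx1]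
  rw [mem_filtration] at hx
  have hleft := mul_mem_triangularIdeal_left (hρ.triangular g) hx
  have hconj := mul_mem_triangularIdeal_right (hρ.triangular g⁻¹) hleft
  rw [hcomm, mul_apply_of_entryIndex_eq_right (hρ.triangular _) (sub_mem hconj hx) hrs, hxs,
    mul_one, Matrix.sub_apply (ρ g * (ρ x - 1) * ρ g⁻¹),
    mul_apply_of_entryIndex_eq_right (hρ.triangular _) hleft hrs,
    mul_apply_of_entryIndex_eq_left (hρ.triangular _) hx hrs]
  ring

/-- The `i`-th layer has at most one matrix entry, on which `g` acts by a scalar. -/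
lemma mem_layerKernel_or_fixedPointFreeOn [NoZeroDivisors E] (hρ : IsTriangularRep ρ) (i : ℕ)
    (g : H) :
    g ∈ layerKernel (hρ.filtration i) (hρ.filtration (i + 1)) (hρ.filtration_normal i) ∨
      FixedPointFreeOn g (hρ.filtration i) (hρ.filtration (i + 1)) := by
  have hcomm : ∀ x ∈ hρ.filtration i, ⁅g, x⁆ ∈ hρ.filtration i := fun x hx =>
    mul_mem ((hρ.filtration_normal i).conj_mem x hx g) (inv_mem hx)
  by_cases hscalar : ∀ r s : Fin n, entryIndex r s = i + n → ρ g r r * ρ g⁻¹ s s = 1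
  · left
    intro x hx
    rw [mem_filtration, mem_triangularIdeal_succ_iff (hcomm x hx)]
    intro r s hrs
    rw [hρ.map_commutator_sub_one_apply hx hrs, hscalar r s hrs, sub_self, zero_mul]
  · right
    push Not at hscalar
    obtain ⟨r, s, hrs, hne⟩ := hscalar
    intro x hx hgx
    rw [mem_filtration, mem_triangularIdeal_succ_iff (hcomm x hx)] at hgx
    rw [mem_filtration, mem_triangularIdeal_succ_iff hx]
    intro r' s' hrs'
    obtain ⟨rfl, rfl⟩ := eq_of_entryIndex_eq hrs hrs'
    have hzero := hgx r s hrs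
    rw [hρ.map_commutator_sub_one_apply hx hrs] at hzero
    exact (mul_eq_zero.1 hzero).resolve_left (sub_ne_zero.2 hne)

lemma commutator_mem_filtration_zero (hρ : IsTriangularRep ρ) (x y : H) :
    ⁅x, y⁆ ∈ hρ.filtration 0 := by
  have hunits : hρ.diag.toHomUnits ⁅x, y⁆ = 1 := by
    rw [map_commutatorElement]
    exact commutatorElement_eq_one_iff_mul_comm.2 (mul_comm _ _)
  exact hρ.mem_filtration_zero.2 (congrArg Units.val hunits)

lemma isPGroup_filtration (hρ : IsTriangularRep ρ) (p : ℕ) [Fact p.Prime] [CharP E p] :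
    IsPGroup p (hρ.filtration 0) := by
  rintro ⟨x, hx⟩
  refine ⟨n, Subtype.ext (hρ.injective ?_)⟩
  rcases isEmpty_or_nonempty (Fin n) with hn | hn
  · exact Subsingleton.elim _ _
  have hle : n ≤ p ^ n := (Nat.lt_pow_self (Fact.out : p.Prime).one_lt).le
  have hzero : (ρ x - 1) ^ p ^ n = 0 :=
    pow_eq_zero_of_le hle (pow_eq_zero_of_mem_triangularIdeal hx)
  rw [sub_pow_char_pow_of_commute _ _ (Commute.one_right _), one_pow, sub_eq_zero,
    ← map_pow] at hzero
  exact hzero.trans (map_one ρ).symm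

/-- The diagonal takes values in a reduced ring of characteristic `p`, which has no nontrivial
`p`-th roots of unity. -/
lemma coprime_index [IsReduced E] (hρ : IsTriangularRep ρ) (p : ℕ) [Fact p.Prime] [CharP E p]
    [Finite H] : p.Coprime (hρ.filtration 0).index := by
  have hprime : p.Prime := Fact.out
  have := hρ.filtration_normal 0
  have hroot : ∀ h : H, h ^ p ∈ hρ.filtration 0 → h ∈ hρ.filtration 0 := by
    intro h hp
    rw [mem_filtration_zero, map_pow] at hp
    rw [mem_filtration_zero]
    funext r
    have hpow : (hρ.diag h r - 1) ^ p = 0 := by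
      have hr : hρ.diag h r ^ p = 1 := congrFun hp r
      rw [sub_pow_char, hr, one_pow, sub_self]
    exact sub_eq_zero.1 (pow_eq_zero_iff hprime.ne_zero |>.1 hpow)
  rw [hprime.coprime_iff_not_dvd, Subgroup.index_eq_card]
  intro hdvd
  obtain ⟨x, hx⟩ := exists_prime_orderOf_dvd_card' p hdvd
  obtain ⟨h, rfl⟩ := QuotientGroup.mk_surjective x
  have hmem : h ∈ hρ.filtration 0 := hroot h <| by
    rw [← QuotientGroup.eq_one_iff, QuotientGroup.mk_pow, ← hx, pow_orderOf_eq_one]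
  rw [(QuotientGroup.eq_one_iff h).2 hmem, orderOf_one] at hx
  exact hprime.one_lt.ne hx

theorem exists_isLayered [IsDomain E] (hρ : IsTriangularRep ρ) (p : ℕ) [Fact p.Prime] [CharP E p]
    [Finite H] : ∃ T : Subgroup H, IsLayered (n * n - n) hρ.filtration T := by
  have := hρ.filtration_normal 0
  have hcop : (Nat.card (hρ.filtration 0)).Coprime (hρ.filtration 0).index := by
    obtain ⟨k, hk⟩ := IsPGroup.iff_card.1 (hρ.isPGroup_filtration p)
    rw [hk]
    exact (hρ.coprime_index p).pow_left k
  obtain ⟨T, hT⟩ := Subgroup.exists_right_complement'_of_coprime hcop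
  exact ⟨T,
    { normal := hρ.filtration_normal
      antitone := hρ.filtration_antitone
      eq_bot := hρ.filtration_eq_bot
      commutator_le := hρ.commutator_filtration_le_succ
      sup_eq_top := hT.sup_eq_top
      comm := fun s hs t ht => commutatorElement_eq_one_iff_mul_comm.1 <|
        Subgroup.disjoint_def.1 hT.disjoint (hρ.commutator_mem_filtration_zero s t)
          (mul_mem (mul_mem (mul_mem hs ht) (inv_mem hs)) (inv_mem ht))
      coprime := hT.symm.index_eq_card ▸ hcop
      semiregular := hρ.mem_layerKernel_or_fixedPointFreeOn }⟩

end IsTriangularRep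

section SmallTripling

open Finset

variable {G : Type*} [Group G] [DecidableEq G] {A : Finset G} {K : ℝ}

/-- `A` and each translate `y • A` with `y ∈ A ^ 3` lie in `A ^ 4`, too small for them to be
disjoint. -/
lemma pow_three_subset_sq_of_card_pow_four_lt (hA : A⁻¹ = A) (h1 : 1 ∈ A)
    (h4 : #(A ^ 4) < 2 * #A) : A ^ 3 ⊆ A ^ 2 := by
  intro y hy
  have htranslate : y • A ⊆ A ^ 4 :=
    (smul_finset_subset_mul hy).trans_eq (pow_succ A 3).symm
  obtain ⟨z, hz⟩ := inter_nonempty_of_card_lt_card_add_card htranslate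
    (subset_pow h1 four_ne_zero) (by rw [card_smul_finset]; omega)
  obtain ⟨hzy, hzA⟩ := mem_inter.1 hz
  obtain ⟨a, ha, rfl⟩ := mem_smul_finset.1 hzy
  rw [← mul_inv_cancel_right y a, sq]
  exact mul_mem_mul hzA (hA ▸ inv_mem_inv ha)

lemma closure_subset_sq_of_pow_three_subset_sq (hA : A⁻¹ = A) (h1 : 1 ∈ A)
    (h3 : A ^ 3 ⊆ A ^ 2) : (Subgroup.closure (A : Set G) : Set G) ⊆ ↑(A ^ 2) := by
  have hmul {a y : G} (ha : a ∈ A) (hy : y ∈ A ^ 2) : a * y ∈ A ^ 2 :=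
    h3 (pow_succ' A 2 ▸ mul_mem_mul ha hy)
  intro x hx
  induction hx using Subgroup.closure_induction_left with
  | one => exact one_mem_pow h1
  | mul_left a ha y _ hy => exact hmul ha hy
  | inv_mul_cancel a ha y _ hy => exact hmul (hA ▸ inv_mem_inv ha) hy

lemma closure_subset_sq_of_small_tripling (hA : A⁻¹ = A) (h1 : 1 ∈ A)
    (hK : (#(A ^ 3) : ℝ) ≤ K * #A) (hK2 : K ^ 2 < 2) :
    (Subgroup.closure (A : Set G) : Set G) ⊆ ↑(A ^ 2) := by
  have hpos : (0 : ℝ) < #A := Nat.cast_pos.2 (card_pos.2 ⟨1, h1⟩)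
  have h4 : (#(A ^ 4) : ℝ) < 2 * #A :=
    calc (#(A ^ 4) : ℝ) ≤ K ^ 2 * #A := small_pow_of_small_tripling (by norm_num) hK hA
      _ < 2 * #A := by gcongr
  exact closure_subset_sq_of_pow_three_subset_sq hA h1
    (pow_three_subset_sq_of_card_pow_four_lt hA h1 (by exact_mod_cast h4))

lemma one_le_of_small_tripling (h1 : 1 ∈ A) (hK : (#(A ^ 3) : ℝ) ≤ K * #A) : 1 ≤ K := by
  have hpos : (0 : ℝ) < #A := Nat.cast_pos.2 (card_pos.2 ⟨1, h1⟩)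
  refine le_of_mul_le_mul_right ?_ hpos
  rw [one_mul]
  exact (Nat.cast_le.2 (card_le_card (subset_pow h1 three_ne_zero))).trans hK

lemma card_pow_le_of_small_tripling (hA : A⁻¹ = A) (h1 : 1 ∈ A)
    (hK : (#(A ^ 3) : ℝ) ≤ K * #A) {k : ℕ} (hk : 1 ≤ k) : (#(A ^ k) : ℝ) ≤ K ^ k * #A := by
  have hK1 := one_le_of_small_tripling h1 hK
  rcases Nat.lt_or_ge k 3 with hk3 | hk3
  · have hKk : K ≤ K ^ k := le_self_pow₀ hK1 (by omega)
    calc (#(A ^ k) : ℝ) ≤ #(A ^ 3) :=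
          Nat.cast_le.2 (card_le_card (pow_subset_pow_right h1 hk3.le))
      _ ≤ K * #A := hK
      _ ≤ K ^ k * #A := by gcongr
  · calc (#(A ^ k) : ℝ) ≤ K ^ (k - 2) * #A := small_pow_of_small_tripling hk3 hK hA
      _ ≤ K ^ k * #A := by gcongr; omega

end SmallTripling

section Roots

variable {S : Type*} [Group S]

lemma CompositionFactor.exists_bot_eq [Finite S] {P X Y : Subgroup S} (hX : X.Normal)
    (hY : Y.Normal) (hYX : Y < X) (hXP : X ≤ P) :
    ∃ V : CompositionFactor P, V.bot = Y ∧ V.top ≤ X := by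
  obtain ⟨Z, ⟨hZ, hYZ, hZX⟩, hmin⟩ := Set.Finite.exists_minimal
    (Set.toFinite {Z : Subgroup S | Z.Normal ∧ Y < Z ∧ Z ≤ X}) ⟨X, hX, hYX, le_rfl⟩
  refine ⟨{ top := Z, bot := Y, top_normal := hZ, bot_normal := hY, top_le := hZX.trans hXP,
            bot_lt_top := hYZ, eq_or_eq := fun W hW hYW hWZ => ?_ }, rfl, hZX⟩
  rcases hYW.eq_or_lt with heq | hlt
  · exact Or.inl heq.symm
  · exact Or.inr (le_antisymm hWZ (hmin ⟨hW, hlt, hWZ.trans hZX⟩ hWZ))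

lemma one_lt_ncard_image_of_closure_eq_top {Q : Type*} [Group Q] {f : S →* Q} (hf : f ≠ 1)
    {A : Set S} (hA : A.Finite) (h1 : 1 ∈ A) (hgen : Subgroup.closure A = ⊤) :
    1 < (f '' A).ncard := by
  rw [Set.one_lt_ncard_iff (hA.image f)]
  by_contra! hle
  refine hf (MonoidHom.eq_of_eqOn_dense hgen fun a ha => ?_)
  rw [MonoidHom.one_apply, ← map_one f]
  exact hle _ _ (Set.mem_image_of_mem f ha) (Set.mem_image_of_mem f h1)

lemma HasNoSmallRoots.lt_ncard_image [Finite S] {p : ℕ} {A : Set S} {R : ℝ}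
    (hA : HasNoSmallRoots p A R) (h1 : 1 ∈ A) (hgen : Subgroup.closure A = ⊤)
    {V : CompositionFactor (pCore p S)} (hV : V.rootKernel ≠ ⊤) : R < (V.root '' A).ncard := by
  have hroot : V.root ≠ 1 := fun h =>
    hV (by rw [← QuotientGroup.ker_mk' V.rootKernel, MonoidHom.ker_eq_top_iff]; exact h)
  by_contra! hle
  exact hA ⟨V, hroot, one_lt_ncard_image_of_closure_eq_top hroot A.toFinite h1 hgen, hle⟩

/-- By semiregularity, the layer `U i / U (i + 1)` has the same centralizer as any composition
factor lying at its bottom. -/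
lemma IsLayered.layerKernel_eq_top_or_lt_ncard [Finite S] {L : ℕ} {U : ℕ → Subgroup S}
    {T : Subgroup S} (h : IsLayered L U T) {p : ℕ} (hp : IsPGroup p (U 0)) {A : Set S}
    (h1 : 1 ∈ A) (hgen : Subgroup.closure A = ⊤) {R : ℝ} (hA : HasNoSmallRoots p A R) (i : ℕ) :
    layerKernel (U i) (U (i + 1)) (h.normal i) = ⊤ ∨
      R < ((fun g : S => (g : S ⧸ layerKernel (U i) (U (i + 1)) (h.normal i))) '' A).ncard := by
  refine or_iff_not_imp_left.2 fun htriv => ?_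
  have hlt : U (i + 1) < U i := by
    refine lt_of_le_of_ne (h.antitone i.le_succ) fun heq => htriv ?_
    refine eq_top_iff.2 fun g _ x hx => ?_
    rw [heq]
    exact mul_mem ((h.normal i).conj_mem x hx g) (inv_mem hx)
  have hcore : U i ≤ pCore p S := (h.antitone i.zero_le).trans (le_sSup ⟨h.normal 0, hp⟩)
  obtain ⟨V, hbot, htop⟩ :=
    CompositionFactor.exists_bot_eq (h.normal i) (h.normal (i + 1)) hlt hcore
  have hle : layerKernel (U i) (U (i + 1)) (h.normal i) ≤ V.rootKernel :=
    fun g hg x hx => hbot ▸ hg x (htop hx)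
  have hge : V.rootKernel ≤ layerKernel (U i) (U (i + 1)) (h.normal i) := fun g hg =>
    (h.semiregular i g).resolve_right fun hfree => V.bot_lt_top.not_ge fun x hx =>
      hbot ▸ hfree x (htop hx) (hbot ▸ hg x hx)
  have hroots : R < (V.root '' A).ncard :=
    hA.lt_ncard_image h1 hgen fun hV => htriv (top_le_iff.1 (hV.ge.trans hge))
  refine hroots.trans_le (Nat.cast_le.2 (ncard_image_le_ncard_image A.toFinite ?_))
  exact fun a _ b _ hab => QuotientGroup.eq.2 (hle (QuotientGroup.eq.1 hab))

end Roots

section TrigonalizableSection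

namespace IsTriangularRep

variable {n : ℕ} {E : Type*} [CommRing E] {H : Type*} [Group H] {ρ : H →* Matrix (Fin n) (Fin n) E}

lemma comp (hρ : IsTriangularRep ρ) {H' : Type*} [Group H'] {f : H' →* H}
    (hf : Function.Injective f) : IsTriangularRep (ρ.comp f) where
  injective := hρ.injective.comp hf
  triangular h := hρ.triangular (f h)

/-- The subgroups `filtration (n * j)`, given by the block superdiagonals, form a central series of
length only `n - 1`. -/
lemma gammaSeries_le (hρ : IsTriangularRep ρ) (hn : 2 ≤ n) {L : ℕ} {T : Subgroup H}
    (hT : IsLayered L hρ.filtration T) : gammaSeries H n ≤ ⁅hρ.filtration 0, T⁆ := by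
  have hpos : 0 < n := by omega
  obtain ⟨k, hk⟩ : ∃ k, n - 1 = k + 1 := ⟨n - 2, by omega⟩
  have hbot : hρ.filtration (n * (k + 1)) = ⊥ := by
    rw [← hk, Nat.mul_sub_one, hρ.filtration_eq_bot]
  have hcomm (j : ℕ) : ⁅hρ.filtration (n * j), hρ.filtration 0⁆ ≤ hρ.filtration (n * (j + 1)) := by
    simpa only [Nat.mul_div_cancel_left _ hpos] using hρ.commutator_filtration_le (n * j)
  have hle := hT.lowerCentralSeries_le (V := fun j => hρ.filtration (n * j))
    (fun j => hρ.filtration_normal _) rfl (fun j => hρ.filtration_antitone (Nat.zero_le _)) hcomm k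
  rw [hbot, bot_sup_eq] at hle
  rwa [gammaSeries, hk]

end IsTriangularRep

lemma IsTrigonalizable.exists_isTriangularRep.{u} {n : ℕ} {F : Type u} [Field F]
    {B : Subgroup (Matrix.GeneralLinearGroup (Fin n) F)} (hB : IsTrigonalizable B) :
    ∃ (E : Type u) (_ : Field E) (_ : Algebra F E) (ρ : B →* Matrix (Fin n) (Fin n) E),
      IsTriangularRep ρ := by
  obtain ⟨E, _, hE, g, hg⟩ := hB
  have hmap : Function.Injective (Matrix.GeneralLinearGroup.map (n := Fin n) (algebraMap F E)) :=
    Units.map_injective (Matrix.map_injective (algebraMap F E).injective)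
  let ρ : B →* Matrix (Fin n) (Fin n) E := (Units.coeHom _).comp <|
    (MulAut.conj g).toMonoidHom.comp <|
      (Matrix.GeneralLinearGroup.map (algebraMap F E)).comp B.subtype
  exact ⟨E, _, hE, ρ, Units.val_injective.comp <|
    (MulAut.conj g).injective.comp (hmap.comp B.subtype_injective), fun b => hg b b.2⟩

lemma surjective_of_sectionTrace_eq_univ {G : Type*} [Group G] {B Γ : Subgroup G} {N : Subgroup Γ}
    [N.Normal] (h : sectionTrace (B : Set G) Γ N = Set.univ) :
    Function.Surjective ((QuotientGroup.mk' N).comp (B.subgroupOf Γ).subtype) := by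
  intro x
  obtain ⟨y, hy, rfl⟩ : x ∈ sectionTrace (B : Set G) Γ N := h ▸ Set.mem_univ x
  exact ⟨⟨y, hy⟩, rfl⟩

theorem IsTrigonalizableSection.exists_isLayered {n : ℕ} (hn : 2 ≤ n) {F : Type*} [Field F]
    [Finite F] (p : ℕ) [CharP F p] {Γ : Subgroup (Matrix.GeneralLinearGroup (Fin n) F)}
    {N : Subgroup Γ} [N.Normal] (h : IsTrigonalizableSection Γ N) :
    ∃ (U : ℕ → Subgroup (Γ ⧸ N)) (T : Subgroup (Γ ⧸ N)), IsLayered (n * n - n) U T ∧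
      IsPGroup p (U 0) ∧ gammaSeries (Γ ⧸ N) n ≤ ⁅U 0, T⁆ := by
  obtain ⟨B, hB, htrace⟩ := h
  obtain ⟨E, _, _, ρ, hρ⟩ := hB.exists_isTriangularRep
  have hp : Fact p.Prime := ⟨CharP.char_is_prime F p⟩
  have hE : CharP E p := charP_of_injective_algebraMap (algebraMap F E).injective p
  let ι : B.subgroupOf Γ →* B := Γ.subtype.subgroupComap B
  have hinj : Function.Injective ι := fun x y hxy => by
    have hval : ((x : Γ) : Matrix.GeneralLinearGroup (Fin n) F) = (y : Γ) :=
      congrArg (fun b : B => (b : Matrix.GeneralLinearGroup (Fin n) F)) hxy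
    exact Subtype.ext (Subtype.ext hval)
  have hρΓ := hρ.comp hinj
  obtain ⟨T, hT⟩ := hρΓ.exists_isLayered p
  have hπ := surjective_of_sectionTrace_eq_univ htrace
  refine ⟨_, _, hT.map _ hπ, (hρΓ.isPGroup_filtration p).map _, ?_⟩
  rw [gammaSeries, ← Subgroup.map_top_of_surjective _ hπ, ← Subgroup.map_lowerCentralSeries,
    ← Subgroup.map_commutator]
  exact Subgroup.map_mono (hρΓ.gammaSeries_le hn hT)

end TrigonalizableSection

section Main

open Finset

/-- A word length in terms of `A` that covers `⁅U 0, T⁆` in a layered group with `L` layers. -/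
def coveringLength (L : ℕ) : ℕ := descentStep^[(L + 1) * L] (commutatorLength (L + 1) + 2)

lemma le_coveringLength (L : ℕ) : commutatorLength (L + 1) + 2 ≤ coveringLength L :=
  le_iterate_descentStep _ _

variable {S : Type*} [Group S] [Finite S] [DecidableEq S] {L : ℕ} {U : ℕ → Subgroup S}
  {T : Subgroup S}

/-- When `K ^ 2 < 2` the descent has no room, but then `A ^ 2` is already the whole group. -/
theorem IsLayered.commutator_subset_pow_of_small_tripling (h : IsLayered L U T) {p : ℕ}
    (hp : IsPGroup p (U 0)) {A : Finset S} {K : ℝ} (hA : A⁻¹ = A) (h1 : 1 ∈ A)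
    (hK : (#(A ^ 3) : ℝ) ≤ K * #A)
    (hroots : HasNoSmallRoots p (A : Set S) (K ^ (54 * coveringLength L + 41)))
    (hgen : Subgroup.closure (A : Set S) = ⊤) :
    ((⁅U 0, T⁆ : Subgroup S) : Set S) ⊆ ↑(A ^ coveringLength L) := by
  have hlen := le_coveringLength L
  rcases lt_or_ge (K ^ 2) 2 with hK2 | hK2
  · have hsq := closure_subset_sq_of_small_tripling hA h1 hK hK2
    rw [hgen] at hsq
    exact (Set.subset_univ _).trans <|
      hsq.trans (coe_subset.2 (pow_subset_pow_right h1 (by omega)))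
  · have hK1 := one_le_of_small_tripling h1 hK
    have hdata : GrowthData L U T A K (K ^ (54 * coveringLength L + 41)) :=
      { toIsLayered := h
        inv_eq := hA
        one_mem := h1
        closure_eq := hgen
        one_le := hK1
        growth := fun _ => card_pow_le_of_small_tripling hA h1 hK
        roots := h.layerKernel_eq_top_or_lt_ncard hp h1 hgen hroots }
    refine hdata.commutator_subset_pow (by omega) (by omega) ?_
    calc 2 * K ^ (54 * coveringLength L + 39) ≤ K ^ 2 * K ^ (54 * coveringLength L + 39) := by
          gcongr
      _ = K ^ (54 * coveringLength L + 41) := by ring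

end Main

theorem mainTheorem7 (n : ℕ) (hn : 2 ≤ n) :
    ∃ C m : ℕ, ∀ (F : Type*) [Field F] [Finite F] (p : ℕ) [CharP F p]
      (Γ : Subgroup (Matrix.GeneralLinearGroup (Fin n) F)) (N : Subgroup Γ) [N.Normal],
      IsTrigonalizableSection Γ N →
      ∀ (A : Set (Γ ⧸ N)) (K : ℝ),
        A⁻¹ = A → 1 ∈ A →
        ((A ^ 3).ncard : ℝ) ≤ K * (A.ncard : ℝ) →
        HasNoSmallRoots p A (K ^ C) →
        Subgroup.closure A = ⊤ →
        ((gammaSeries (Γ ⧸ N) n : Subgroup (Γ ⧸ N)) : Set (Γ ⧸ N)) ⊆ A ^ m := by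
  classical
  refine ⟨54 * coveringLength (n * n - n) + 41, coveringLength (n * n - n), ?_⟩
  intro F _ _ p _ Γ N _ htrig A K hinv hone hK hroots hgen
  obtain ⟨U, T, hlayered, hU, hgamma⟩ := htrig.exists_isLayered hn p
  obtain ⟨A, rfl⟩ : ∃ A' : Finset (Γ ⧸ N), (A' : Set (Γ ⧸ N)) = A :=
    ⟨A.toFinite.toFinset, A.toFinite.coe_toFinset⟩
  rw [← Finset.coe_inv, Finset.coe_inj] at hinv
  rw [← Finset.coe_pow, Set.ncard_coe_finset, Set.ncard_coe_finset] at hK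
  rw [← Finset.coe_pow]
  exact (SetLike.coe_subset_coe.2 hgamma).trans
    (hlayered.commutator_subset_pow_of_small_tripling hU hinv hone hK hroots hgen)
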